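/- **Setting.** Let $U\subseteq\mathbb R^N$ be a connected open set with coordinates $u^1,\dots,u^N$. Let $u^{i,\sigma}$ denote the jet variables, $u^{i,0}=u^i$. Let $\mathcal A_d$ be the space of polynomials in the $u^{i,\sigma}$, $\sigma\ge 1$, with coefficients in $C^\infty(U)$, that are homogeneous of degree $d$ for $\deg u^{i,\sigma}=\sigma$, and let $\partial_x=\sum u^{i,\sigma+1}\partial/\partial u^{i,\sigma}$. A *weakly non-local bivector of localizable shape* is a formal (pseudo)differential operator $$P^{ij}=\sum_{d\ge 1}\epsilon^{d-1}\Big(\sum_{s=0}^{d}P^{ij}_{d,d-s}\,\partial_x^{s}+u^{i,1}\partial_x^{-1}V_d^j+V_d^i\,\partial_x^{-1}u^{j,1}\Big),\qquad P^{ij}_{d,k}\in\mathcal A_k,\ V^i_d\in\mathcal A_d,$$ whose local part is skew-adjoint. Its *symbol* is the matrix $\sum_{d\ge1}\epsilon^{d-1}P^{ij}_{d,0}$ over $C^\infty(U)[[\epsilon]]$. Let $P_2-\lambda P_1$ be a pencil of two such bivectors with semisimple leading term. That is, there are canonical coordinates $r^1,\dots,r^N$: smooth functions on $U$ with nowhere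 vanishing Jacobian, pairwise distinct at every point, in which the metrics $P^{ij}_{1;1,0}$ and $P^{ij}_{2;1,0}$ become $\mathrm{diag}(f^i)$ and $\mathrm{diag}(r^if^i)$ with $f^i$ nowhere zero. (No Poisson property and no locality of the leading term are needed. In particular the result holds for the space $T^{nl}$ of weakly non-local Poisson pencils of localizable shape with a local semisimple leading term.) **The group.** A *Miura-reciprocal transformation* is $$dy=B\,dx,\quad w^i=Q^i,\qquad B=\sum_{k\ge0}\epsilon^kH_k,\quad Q^i=\sum_{k\ge0}\epsilon^kK^i_k,\qquad H_k,K^i_k\in\mathcal A_k,$$ where $H_0$ is nowhere zero and $K_0=(K^1_0,\dots,K^N_0)$ is a change of coordinates of $U$ onto an open set $W$ (a bijection with nowhere vanishing Jacobian). It acts on bivectors by $$P'^{hk}=\tfrac1B\,\mathcal D^h_i\,P^{ij}\,(\mathcal D^*)^k_j,\qquad \mathcal D^j_i=B\sum_\sigma\frac{\partial Q^j}{\partial u^{i,\sigma}}\partial_x^\sigma-(\partial_xQ^j)\,\partial_x^{-1}\sum_\sigma\frac{\partial B}{\partial u^{i,\sigma}}\partial_x^\sigma,$$ with the result rewritten in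 terms of $w^{i,\tau}=(\tfrac1B\partial_x)^\tau Q^i$ and $\partial_y=\tfrac1B\partial_x$. **Proposition.** Let $P'_2-\lambda P'_1$ be a pencil of weakly non-local bivectors of localizable shape on $W$ that is the image of $P_2-\lambda P_1$ under a Miura-reciprocal transformation. Then: 1. For each $i$ the polynomial $\det\big(\sum_{d}\epsilon^{d-1}(P_{2;d,0}-\lambda P_{1;d,0})\big)$ in $\lambda$ has exactly one root $\lambda^i\in C^\infty(U)[[\epsilon]]$ with leading term $r^i$, and it is even in $\epsilon$: $\lambda^i=r^i+\epsilon^2\lambda^i_2+\epsilon^4\lambda^i_4+\cdots$. 2. The image pencil also has canonical coordinates on $W$, and for any choice $r'^i$ of them, with diagonal entries $f'^i$ of its first metric, (1) holds for it as well, with roots $\lambda'^i$. 3. The quantities $$c^i_{2k}=\frac{\lambda^i_{2k}}{(f^i)^k},\qquad k=0,1,2,\dots,$$ are invariant: up to a permutation $\sigma$ of the indices that does not depend on $k$ or on the point, $$\frac{\lambda'^{\sigma(i)}_{2k}}{(f'^{\sigma(i)})^k}\circ K_0=\frac{\lambda^i_{2k}}{(f^i)^k}\quad\text{on }U,\qquad\text{for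 all } i \text{ and all } k\ge0 .$$ -/

import Mathlib

open scoped ContDiff

noncomputable section

namespace MiuraReciprocal

open TopologicalSpace

/-! ### Smooth functions on an open subset of `ℝ^N` -/

/-- Extension by zero of a function on `U`. -/
def extendZero {N : ℕ} {U : Opens (Fin N → ℝ)} (f : U → ℝ) : (Fin N → ℝ) → ℝ :=
  Function.extend Subtype.val f 0

theorem extendZero_apply {N : ℕ} {U : Opens (Fin N → ℝ)} (f : U → ℝ) (x : U) :
    extendZero f x.1 = f x :=
  Subtype.val_injective.extend_apply f 0 x

theorem extendZero_of_mem {N : ℕ} {U : Opens (Fin N → ℝ)} (f : U → ℝ) {x : Fin N → ℝ}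
    (hx : x ∈ U) : extendZero f x = f ⟨x, hx⟩ :=
  extendZero_apply f ⟨x, hx⟩

/-- The real-valued smooth functions on the open set `U ⊆ ℝ^N`. -/
def smoothSubalgebra {N : ℕ} (U : Opens (Fin N → ℝ)) : Subalgebra ℝ (U → ℝ) where
  carrier := {f | ContDiffOn ℝ ∞ (extendZero f) (U : Set (Fin N → ℝ))}
  mul_mem' {f g} hf hg := (ContDiffOn.mul hf hg).congr fun x hx => by
    simp [extendZero_of_mem _ (show x ∈ U from hx)]
  add_mem' {f g} hf hg := (ContDiffOn.add hf hg).congr fun x hx => by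
    simp [extendZero_of_mem _ (show x ∈ U from hx)]
  algebraMap_mem' c := (contDiffOn_const (c := c)).congr fun x hx => by
    simp [extendZero_of_mem _ (show x ∈ U from hx)]

/-- The ring `C^∞(U)`. -/
def Smooth {N : ℕ} (U : Opens (Fin N → ℝ)) : Type := smoothSubalgebra U

instance {N : ℕ} (U : Opens (Fin N → ℝ)) : CommRing (Smooth U) :=
  inferInstanceAs (CommRing (smoothSubalgebra U))

instance {N : ℕ} (U : Opens (Fin N → ℝ)) : Algebra ℝ (Smooth U) :=
  inferInstanceAs (Algebra ℝ (smoothSubalgebra U))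

instance {N : ℕ} (U : Opens (Fin N → ℝ)) : CoeFun (Smooth U) fun _ => U → ℝ :=
  ⟨fun f => f.1⟩

/-- The partial derivative `∂f/∂u^i` of a smooth function on `U`. -/
def pd {N : ℕ} {U : Opens (Fin N → ℝ)} (i : Fin N) (f : Smooth U) : Smooth U :=
  ⟨fun x => fderiv ℝ (extendZero f.1) x.1 (Pi.single i 1), by
    have h1 : ContDiffOn ℝ ∞ (fun x => fderiv ℝ (extendZero f.1) x) (U : Set (Fin N → ℝ)) :=
      ContDiffOn.fderiv_of_isOpen (m := ∞) f.2 U.isOpen (by simp)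
    exact (h1.clm_apply contDiffOn_const).congr fun x hx =>
      extendZero_of_mem _ (show x ∈ U from hx)⟩

/-- Iterated partial derivative `∂_{l_1} ∂_{l_2} ⋯ f` along a list of indices. -/
def pdList {N : ℕ} {U : Opens (Fin N → ℝ)} (l : List (Fin N)) (f : Smooth U) : Smooth U :=
  l.foldr pd f

/-- The composition `F ∘ K` of a smooth function `F` on `W` with a map `K : U → W` all of whose
components are smooth. -/
def Smooth.pull {N : ℕ} {U W : Opens (Fin N → ℝ)} (K : U → W)
    (hK : ∀ i, (fun x => (K x).1 i) ∈ smoothSubalgebra U) (F : Smooth W) : Smooth U :=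
  ⟨fun x => F (K x), by
    have h1 : ContDiffOn ℝ ∞ (fun x i => extendZero (fun y => (K y).1 i) x)
        (U : Set (Fin N → ℝ)) := contDiffOn_pi.2 fun i => hK i
    have key : ∀ x (hx : x ∈ U),
        (fun i => extendZero (fun y => (K y).1 i) x) = (K ⟨x, hx⟩).1 := fun x hx => by
      funext i; exact extendZero_of_mem _ hx
    have h2 : ContDiffOn ℝ ∞ (extendZero F.1) (W : Set (Fin N → ℝ)) := F.2
    refine (h2.comp h1 fun x hx => ?_).congr fun x hx => ?_
    · rw [key x hx]; exact (K ⟨x, hx⟩).2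
    · rw [extendZero_of_mem _ (show x ∈ U from hx), Function.comp_apply, key x hx,
        extendZero_apply]⟩

/-! ### Differential polynomials -/

/-- Differential polynomials on `U`: polynomials with coefficients in `C^∞(U)` in the jet
variables `u^{i,σ}`, `σ ≥ 1`. The variable `X (i, s)` is `u^{i,s+1}`. -/
abbrev DiffPoly {N : ℕ} (U : Opens (Fin N → ℝ)) : Type :=
  MvPolynomial (Fin N × ℕ) (Smooth U)

/-- `f ∈ 𝒜_d`: `f` is homogeneous of differential degree `d`, where `u^{i,σ}` has degree `σ`. -/
def HasDegree {N : ℕ} {U : Opens (Fin N → ℝ)} (f : DiffPoly U) (d : ℕ) : Prop :=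
  MvPolynomial.IsWeightedHomogeneous (fun p : Fin N × ℕ => p.2 + 1) f d

/-- `∂f/∂u^{i,σ}`; for `σ = 0` the derivative acts on the coefficients. -/
def jetPd {N : ℕ} {U : Opens (Fin N → ℝ)} (i : Fin N) (σ : ℕ) (f : DiffPoly U) : DiffPoly U :=
  match σ with
  | 0 => ∑ m ∈ f.support, MvPolynomial.monomial m (pd i (f.coeff m))
  | s + 1 => MvPolynomial.pderiv (i, s) f

/-- The total derivative `∂_x = ∑ u^{i,σ+1} ∂/∂u^{i,σ}`. -/
def totalD {N : ℕ} {U : Opens (Fin N → ℝ)} (f : DiffPoly U) : DiffPoly U :=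
  ∑ i, MvPolynomial.X (i, 0) * jetPd i 0 f +
    ∑ p ∈ f.vars, MvPolynomial.X (p.1, p.2 + 1) * jetPd p.1 (p.2 + 1) f

/-- The part of a differential polynomial that does not contain the jet variables. -/
def base {N : ℕ} {U : Opens (Fin N → ℝ)} (f : DiffPoly U) : Smooth U :=
  MvPolynomial.constantCoeff f

/-- Formal power series in `ε` whose coefficients are differential polynomials. -/
abbrev EpsPoly {N : ℕ} (U : Opens (Fin N → ℝ)) : Type :=
  PowerSeries (DiffPoly U)

/-- The total derivative `∂_x`, extended `ε`-linearly. -/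
def epsD {N : ℕ} {U : Opens (Fin N → ℝ)} (f : EpsPoly U) : EpsPoly U :=
  PowerSeries.mk fun n => totalD (PowerSeries.coeff n f)

/-! ### Formal pseudodifferential operators -/

/-- Formal pseudodifferential operators `∑_n ε^n ∑_{m ≤ M_n} a_{n,m} ∂_x^m`, `m ∈ ℤ`, with
differential polynomials `a_{n,m}` as coefficients: the operator is the family `a`, and for each
`n` the orders `m` that occur are bounded above. -/
def PDO {N : ℕ} (U : Opens (Fin N → ℝ)) : AddSubgroup (ℕ → ℤ → DiffPoly U) where
  carrier := {a | ∀ n, ∃ M : ℤ, ∀ m, M < m → a n m = 0}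
  zero_mem' _ := ⟨0, fun _ _ => rfl⟩
  add_mem' {a b} ha hb n := by
    obtain ⟨M, hM⟩ := ha n
    obtain ⟨M', hM'⟩ := hb n
    refine ⟨max M M', fun m hm => ?_⟩
    simp [hM m (lt_of_le_of_lt (le_max_left _ _) hm),
      hM' m (lt_of_le_of_lt (le_max_right _ _) hm)]
  neg_mem' {a} ha n := by
    obtain ⟨M, hM⟩ := ha n
    refine ⟨M, fun m hm => ?_⟩
    simp [hM m hm]

namespace PDO

variable {N : ℕ} {U : Opens (Fin N → ℝ)}

/-- Multiplication by `f`, an operator of order zero. -/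
def ofFun (f : EpsPoly U) : PDO U :=
  ⟨fun n m => if m = 0 then PowerSeries.coeff n f else 0,
    fun _ => ⟨0, fun _ hm => if_neg (ne_of_gt hm)⟩⟩

/-- The operator `∂_x^k`, `k ∈ ℤ`. -/
def dPow (U : Opens (Fin N → ℝ)) (k : ℤ) : PDO U :=
  ⟨fun n m => if n = 0 ∧ m = k then 1 else 0,
    fun _ => ⟨k, fun _ hm => if_neg fun h => (ne_of_gt hm) h.2⟩⟩

/-- Composition, given by the generalized Leibniz rule
`(a ∂^m) ∘ (b ∂^l) = ∑_{k ≥ 0} (m choose k) a (∂_x^k b) ∂^{m + l - k}`; for bounded orders only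
finitely many terms contribute to each coefficient. -/
def comp (A B : PDO U) : PDO U :=
  ⟨fun n r => ∑ p ∈ Finset.HasAntidiagonal.antidiagonal n, ∑ᶠ q : ℤ × ℕ,
      Ring.choose q.1 q.2 • (A.1 p.1 q.1 * totalD^[q.2] (B.1 p.2 (r - q.1 + q.2))), by
    have hz : ∀ k : ℕ, totalD^[k] (0 : DiffPoly U) = 0 := fun k => by
      induction k with
      | zero => rfl
      | succ k ih =>
        rw [Function.iterate_succ_apply', ih]
        simp [totalD, jetPd]
    intro n
    choose Ma hMa using A.2
    choose Mb hMb using B.2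
    obtain ⟨M, hM⟩ := ((Finset.HasAntidiagonal.antidiagonal n).image fun p => Ma p.1 + Mb p.2).bddAbove
    refine ⟨M, fun r hr => Finset.sum_eq_zero fun p hp => ?_⟩
    have hp' : Ma p.1 + Mb p.2 ≤ M := hM (by
      simpa using ⟨p.1, p.2, by simpa using hp, rfl⟩)
    refine finsum_eq_zero_of_forall_eq_zero fun q => ?_
    by_cases h : Ma p.1 < q.1
    · rw [hMa p.1 q.1 h]; simp
    · have : Mb p.2 < r - q.1 + q.2 := by
        have : (0 : ℤ) ≤ q.2 := Int.natCast_nonneg _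
        omega
      rw [hMb p.2 _ this, hz]; simp⟩

infixl:70 " ⊚ " => MiuraReciprocal.PDO.comp

/-- The formal adjoint: `(a ∂^m)^* = (-∂)^m ∘ a = (-1)^m ∑_{k ≥ 0} (m choose k) (∂_x^k a) ∂^{m-k}`. -/
def adjoint (A : PDO U) : PDO U :=
  ⟨fun n r => ∑ᶠ k : ℕ, (((r + k).negOnePow : ℤ) * Ring.choose (r + k) k) •
      totalD^[k] (A.1 n (r + k)), by
    have hz : ∀ k : ℕ, totalD^[k] (0 : DiffPoly U) = 0 := fun k => by
      induction k with
      | zero => rfl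
      | succ k ih =>
        rw [Function.iterate_succ_apply', ih]
        simp [totalD, jetPd]
    intro n
    obtain ⟨M, hM⟩ := A.2 n
    refine ⟨M, fun r hr => finsum_eq_zero_of_forall_eq_zero fun k => ?_⟩
    rw [hM (r + k) (by have : (0 : ℤ) ≤ k := Int.natCast_nonneg _
                       omega), hz, smul_zero]⟩

/-- The `i`-th component `∑_σ (∂F/∂u^{i,σ}) ∂_x^σ` of the Fréchet derivative of `F`. -/
def frechet (F : EpsPoly U) (i : Fin N) : PDO U :=
  ⟨fun n m => if 0 ≤ m then jetPd i m.toNat (PowerSeries.coeff n F) else 0, fun n => by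
    refine ⟨((PowerSeries.coeff n F).vars.sup fun p => p.2 + 1 : ℕ), fun m hm => ?_⟩
    have hm0 : 0 ≤ m := le_of_lt (lt_of_le_of_lt (Int.natCast_nonneg _) hm)
    beta_reduce
    rw [if_pos hm0]
    obtain ⟨k, rfl⟩ := Int.eq_ofNat_of_zero_le hm0
    cases k with
    | zero => exact absurd hm (not_lt.2 (by simp))
    | succ s =>
      simp only [Int.toNat_natCast, jetPd]
      refine MvPolynomial.pderiv_eq_zero_of_notMem_vars fun hmem => ?_
      have := Finset.le_sup (f := fun p : Fin N × ℕ => p.2 + 1) hmem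
      simp only at this
      omega⟩

end PDO

/-! ### Weakly non-local bivectors of localizable shape -/

/-- A dispersive weakly non-local bivector of localizable shape
`P^{ij} = ∑_{n ≥ 0} ε^n (∑_{s ≤ n+1} P^{ij}_{n,s} ∂_x^s + u^{i,1} ∂_x^{-1} V_n^j
  + V_n^i ∂_x^{-1} u^{j,1})`
with `P^{ij}_{n,s} ∈ 𝒜_{n+1-s}` and `V_n^i ∈ 𝒜_{n+1}`, the local part being skew-adjoint
(the non-local part always is). The term of index `n` has differential degree `d = n + 1`. -/
structure Bivector {N : ℕ} (U : Opens (Fin N → ℝ)) where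
  /-- The local part, a matrix of differential operators. -/
  loc : Fin N → Fin N → PDO U
  /-- `nonloc n i` is `V_n^i`. -/
  nonloc : ℕ → Fin N → DiffPoly U
  loc_degree : ∀ i j (n s : ℕ), s ≤ n + 1 → HasDegree ((loc i j).1 n s) (n + 1 - s)
  loc_eq_zero : ∀ i j (n : ℕ) (m : ℤ), m < 0 ∨ n + 1 < m → (loc i j).1 n m = 0
  nonloc_degree : ∀ n i, HasDegree (nonloc n i) (n + 1)
  skew : ∀ i j, PDO.adjoint (loc i j) = -loc j i

namespace Bivector

variable {N : ℕ} {U : Opens (Fin N → ℝ)}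

/-- The series `V^i = ∑_n ε^n V_n^i`. -/
def tail (P : Bivector U) (i : Fin N) : EpsPoly U :=
  PowerSeries.mk fun n => P.nonloc n i

/-- The operator `P^{ij}`, as a formal pseudodifferential operator. -/
def op (P : Bivector U) (i j : Fin N) : PDO U :=
  P.loc i j +
    PDO.ofFun (PowerSeries.C (MvPolynomial.X (i, 0))) ⊚ PDO.dPow U (-1) ⊚ PDO.ofFun (P.tail j) +
    PDO.ofFun (P.tail i) ⊚ PDO.dPow U (-1) ⊚ PDO.ofFun (PowerSeries.C (MvPolynomial.X (j, 0)))

/-- The symbol `∑_n ε^n P^{ij}_{n,n+1}`, a matrix of power series in `ε` over `C^∞(U)`: the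
coefficient of `ε^n ∂_x^{n+1}` has differential degree `0`. -/
def symbol (P : Bivector U) : Matrix (Fin N) (Fin N) (PowerSeries (Smooth U)) :=
  Matrix.of fun i j => PowerSeries.mk fun n => base ((P.loc i j).1 n (n + 1))

/-- The contravariant metric `g^{ij}`: the coefficient of `∂_x` in the leading term. -/
def metric (P : Bivector U) (i j : Fin N) : Smooth U :=
  base ((P.loc i j).1 0 1)

end Bivector

/-- A pencil `P_2 - λ P_1` of weakly non-local bivectors of localizable shape. -/
structure Pencil {N : ℕ} (U : Opens (Fin N → ℝ)) where
  fst : Bivector U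
  snd : Bivector U

namespace Pencil

variable {N : ℕ} {U : Opens (Fin N → ℝ)}

/-- The characteristic polynomial `det (symbol of P_2 - λ P_1)`, a polynomial in `λ`. -/
def charPoly (P : Pencil U) : Polynomial (PowerSeries (Smooth U)) :=
  Matrix.det (P.snd.symbol.map Polynomial.C -
    (Polynomial.X : Polynomial (PowerSeries (Smooth U))) • P.fst.symbol.map Polynomial.C)

/-- `r^1, …, r^N` are canonical coordinates of the (semisimple) leading term of the pencil: they
have nowhere vanishing Jacobian, they are pairwise distinct at every point, and in the coordinates
`r^i` the first metric is `diag(f^i)`, without zeros, and the second is `diag(r^i f^i)`. -/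
structure IsCanonical (P : Pencil U) (r f : Fin N → Smooth U) : Prop where
  jacobian : ∀ x, Matrix.det (Matrix.of fun i j => pd j (r i) x) ≠ 0
  distinct : ∀ x i j, i ≠ j → r i x ≠ r j x
  nondegenerate : ∀ x i, f i x ≠ 0
  fst_metric : ∀ i j, ∑ k, ∑ l, pd k (r i) * P.fst.metric k l * pd l (r j) =
    if i = j then f i else 0
  snd_metric : ∀ i j, ∑ k, ∑ l, pd k (r i) * P.snd.metric k l * pd l (r j) =
    if i = j then r i * f i else 0

/-- `lam i` is a root `r^i + O(ε)` of the characteristic polynomial, for every `i`. -/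
def IsRootSystem (P : Pencil U) (r : Fin N → Smooth U)
    (lam : Fin N → PowerSeries (Smooth U)) : Prop :=
  ∀ i, P.charPoly.IsRoot (lam i) ∧ PowerSeries.constantCoeff (lam i) = r i

end Pencil

/-- The function `λ_{2k} / f^k` on `U`. -/
def invariant {N : ℕ} {U : Opens (Fin N → ℝ)} (lam : PowerSeries (Smooth U)) (f : Smooth U)
    (k : ℕ) (x : U) : ℝ :=
  PowerSeries.coeff (2 * k) lam x / f x ^ k

/-! ### Miura-reciprocal transformations and their action -/

/-- A Miura-reciprocal transformation `dy = B dx`, `w^i = Q^i`, `B = ∑ ε^k H_k`,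
`Q^i = ∑ ε^k K^i_k`, with `H_k, K^i_k ∈ 𝒜_k`, `H_0` nowhere zero, and `K_0` a change of
coordinates from `U` to `W` (a bijection whose Jacobian vanishes nowhere). -/
structure Transformation {N : ℕ} (U W : Opens (Fin N → ℝ)) where
  B : EpsPoly U
  Q : Fin N → EpsPoly U
  B_degree : ∀ k, HasDegree (PowerSeries.coeff k B) k
  Q_degree : ∀ i k, HasDegree (PowerSeries.coeff k (Q i)) k
  H₀_ne_zero : ∀ x, base (PowerSeries.coeff 0 B) x ≠ 0
  K₀_bijOn : Set.BijOn
    (fun x i => extendZero (base (PowerSeries.coeff 0 (Q i))) x) (U : Set (Fin N → ℝ)) W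
  jacobian : ∀ x,
    Matrix.det (Matrix.of fun i j => pd j (base (PowerSeries.coeff 0 (Q i))) x) ≠ 0

namespace Transformation

variable {N : ℕ} {U W : Opens (Fin N → ℝ)}

/-- The leading part `K_0 : U → W`. -/
def K₀ (T : Transformation U W) (x : U) : W :=
  ⟨fun i => base (PowerSeries.coeff 0 (T.Q i)) x, by
    have h := T.K₀_bijOn.mapsTo x.2
    simp only [extendZero_apply] at h
    exact h⟩

theorem K₀_smooth (T : Transformation U W) (i : Fin N) :
    (fun x => (T.K₀ x).1 i) ∈ smoothSubalgebra U :=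
  (base (PowerSeries.coeff 0 (T.Q i))).2

/-- The inverse `1 / B` in the ring of power series in `ε` (`B` is invertible since `H_0` is). -/
def Binv (T : Transformation U W) : EpsPoly U :=
  Ring.inverse T.B

/-- `w^{i,τ} = ((1/B) ∂_x)^τ Q^i`. -/
def jet (T : Transformation U W) (i : Fin N) (τ : ℕ) : EpsPoly U :=
  (fun F => T.Binv * epsD F)^[τ] (T.Q i)

/-- The result of substituting `w = Q = K_0 + ε K_1 + ⋯` in a smooth function `F(w)`, by Taylor
expansion at `K_0`: with `h = Q - K_0`,
`F(Q) = ∑_l (1/l!) ∑_{s_1, …, s_l} (∂_{s_1} ⋯ ∂_{s_l} F)(K_0) h^{s_1} ⋯ h^{s_l}`.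
Since `h = O(ε)`, the terms with `l > n` do not contribute to `ε^n`. -/
def substSmooth (T : Transformation U W) (F : Smooth W) : EpsPoly U :=
  PowerSeries.mk fun n => ∑ l ∈ Finset.range (n + 1), ∑ s : Fin l → Fin N,
    MvPolynomial.C (((l.factorial : ℝ)⁻¹) •
        Smooth.pull T.K₀ T.K₀_smooth (pdList (List.ofFn s) F)) *
      PowerSeries.coeff n (∏ a, (T.Q (s a) -
        PowerSeries.C (MvPolynomial.C (base (PowerSeries.coeff 0 (T.Q (s a)))))))

/-- A differential polynomial in `w`, rewritten in terms of `u`. -/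
def subst (T : Transformation U W) (f : DiffPoly W) : EpsPoly U :=
  ∑ m ∈ f.support, T.substSmooth (f.coeff m) * m.prod fun p e => T.jet p.1 (p.2 + 1) ^ e

/-- A power series in `ε` of differential polynomials in `w`, rewritten in terms of `u`. -/
def substEps (T : Transformation U W) (f : EpsPoly W) : EpsPoly U :=
  PowerSeries.mk fun n => ∑ p ∈ Finset.HasAntidiagonal.antidiagonal n,
    PowerSeries.coeff p.2 (T.subst (PowerSeries.coeff p.1 f))

/-- `∂_y^s = ((1/B) ∂_x)^s`, `s ≥ 0`, in terms of `∂_x`. -/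
def dyPow (T : Transformation U W) : ℕ → PDO U
  | 0 => PDO.ofFun 1
  | s + 1 => PDO.ofFun T.Binv ⊚ PDO.dPow U 1 ⊚ T.dyPow s

/-- The terms `ε^a P^{ij}_{a,s} ∂_y^s`, `a ≤ n`, of the local part of a bivector in the
coordinates `(y, w)`, rewritten in terms of `u` and `∂_x`. -/
def pullLocTrunc (T : Transformation U W) (P : Bivector W) (i j : Fin N) (n : ℕ) : PDO U :=
  ∑ a ∈ Finset.range (n + 1), ∑ s ∈ Finset.range (a + 2),
    PDO.ofFun (PowerSeries.X ^ a * T.subst ((P.loc i j).1 a s)) ⊚ T.dyPow s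

/-- The local part of a bivector in the coordinates `(y, w)`, rewritten in terms of `u` and
`∂_x`; the terms with `a > n` do not contribute to `ε^n`. -/
def pullLoc (T : Transformation U W) (P : Bivector W) (i j : Fin N) : PDO U :=
  ⟨fun n m => (T.pullLocTrunc P i j n).1 n m, fun n => (T.pullLocTrunc P i j n).2 n⟩

/-- A bivector `∑ P^{ij}_s ∂_y^s + w^{i,1} ∂_y^{-1} V^j + V^i ∂_y^{-1} w^{j,1}` in the coordinates
`(y, w)`, rewritten in terms of `u` and `∂_x`; here `∂_y^{-1} = ∂_x^{-1} ∘ B`. -/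
def pull (T : Transformation U W) (P : Bivector W) (i j : Fin N) : PDO U :=
  T.pullLoc P i j +
    PDO.ofFun (T.jet i 1) ⊚ PDO.dPow U (-1) ⊚ PDO.ofFun (T.B * T.substEps (P.tail j)) +
    PDO.ofFun (T.substEps (P.tail i)) ⊚ PDO.dPow U (-1) ⊚ PDO.ofFun (T.B * T.jet j 1)

/-- The operator `𝒟^j_i = B (ℓ_{Q^j})_i - (∂_x Q^j) ∘ ∂_x^{-1} ∘ (ℓ_B)_i`. -/
def D (T : Transformation U W) (j i : Fin N) : PDO U :=
  PDO.ofFun T.B ⊚ PDO.frechet (T.Q j) i -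
    PDO.ofFun (epsD (T.Q j)) ⊚ PDO.dPow U (-1) ⊚ PDO.frechet T.B i

/-- `P'`, written in the coordinates `(y, w)`, is the image of the bivector `P`, written in the
coordinates `(x, u)`: `P'^{hk} = (1/B) 𝒟^h_i P^{ij} (𝒟^*)^k_j` as operators. -/
def MapsBivector (T : Transformation U W) (P : Bivector U) (P' : Bivector W) : Prop :=
  ∀ h k, T.pull P' h k = PDO.ofFun T.Binv ⊚
    ∑ i, ∑ j, T.D h i ⊚ P.op i j ⊚ PDO.adjoint (T.D k j)

/-- The pencil `P'` is the image of the pencil `P` under the transformation. -/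
def MapsPencil (T : Transformation U W) (P : Pencil U) (P' : Pencil W) : Prop :=
  T.MapsBivector P.fst P'.fst ∧ T.MapsBivector P.snd P'.snd

end Transformation

end MiuraReciprocal

end

noncomputable section

namespace MiuraReciprocal

open TopologicalSpace

/-! ### Formal roots -/

section FormalRoots

variable {R : Type*} [CommRing R]

/-! Setting all jet variables to zero turns the operator calculus into commutative algebra. A total
derivative has no jet-free part (`base_totalD`), so in compositions and adjoints only the leading
Leibniz term survives. By homogeneity the coefficient of `ε^n` then occurs with a single power
`∂_x^(n+c)`, so an operator reduces to one power series over `C^∞(U)`. Composition becomes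
multiplication (`HasSymbol.comp`), and the adjoint becomes the substitution `ε ↦ -ε` up to sign
(`HasSymbol.adjoint`). All non-local tails reduce to zero.

Skew-adjointness therefore says `S(-ε) = S(ε)ᵀ` for the symbol `S`, so the roots of the determinant
are permuted by `ε ↦ -ε`. Since the `r i` are pairwise distinct, they are simple roots at `ε = 0`,
and Hensel's lemma lifts each uniquely. Uniqueness makes each lift even.

Under a transformation, `∂_y` reduces to `∂_x / H_0`, so composition with `K_0` comes with the
rescaling of `ε` by `1 / H_0`. Both symbols change by the same factors: `S' ↦ H_0² F(ε) S F(-ε)ᵀ`,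
with `F` the invertible symbol of the Fréchet derivative of `Q` (`MapsBivector.symbol_map`). Hence
roots correspond, `λ'_n ∘ K_0 = H_0^n λ_n`, while the metrics give `f' ∘ K_0 = H_0² f`, and the
powers of `H_0` cancel in `λ_{2k} / f^k`. Connectedness of `U` makes the matching of indices
constant. -/

theorem existsUnique_root_of_simple {p : Polynomial (PowerSeries R)} (hp : p.Monic)
    (a : R) (ha : (p.map PowerSeries.constantCoeff).eval a = 0)
    (ha' : IsUnit ((p.map PowerSeries.constantCoeff).derivative.eval a)) :
    ∃! b : PowerSeries R, p.IsRoot b ∧ PowerSeries.constantCoeff b = a := by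
  have hmem : ∀ b : PowerSeries R,
      b ∈ Ideal.span {(PowerSeries.X : PowerSeries R)} ↔ PowerSeries.constantCoeff b = 0 :=
    fun b => by rw [Ideal.mem_span_singleton, PowerSeries.X_dvd_iff]
  have hcc : ∀ (q : Polynomial (PowerSeries R)) (b : PowerSeries R),
      PowerSeries.constantCoeff (q.eval b) =
        (q.map PowerSeries.constantCoeff).eval (PowerSeries.constantCoeff b) := fun q b => by
    rw [Polynomial.eval_map_apply]
  have hunit : ∀ b : PowerSeries R, PowerSeries.constantCoeff b = a →
      IsUnit (p.derivative.eval b) := fun b hb => by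
    rw [PowerSeries.isUnit_iff_constantCoeff, hcc, hb, ← Polynomial.derivative_map]
    exact ha'
  -- Power series are complete along `(X)`; the constant series `a` is the approximate root.
  obtain ⟨b, hb, hba⟩ := HenselianRing.is_henselian (I := Ideal.span {(PowerSeries.X : PowerSeries R)})
    p hp (PowerSeries.C a) ((hmem _).2 (by rw [hcc, PowerSeries.constantCoeff_C, ha]))
    ((hunit _ (PowerSeries.constantCoeff_C a)).map _)
  rw [hmem, map_sub, PowerSeries.constantCoeff_C, sub_eq_zero] at hba
  refine ⟨b, ⟨hb, hba⟩, fun c hc => ?_⟩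
  -- `R` may have zero divisors. Expanding at `b` to second order writes `p(c) = 0` as `(p'(b) + k(c
  -- - b))(c - b) = 0`, whose first factor has the same constant term as `p'(b)`, a unit.
  obtain ⟨k, hk⟩ := Polynomial.binomExpansion p b (c - b)
  rw [add_sub_cancel, hc.1.eq_zero, hb.eq_zero] at hk
  have h : (p.derivative.eval b + k * (c - b)) * (c - b) = 0 := by
    linear_combination -hk
  have hu : IsUnit (p.derivative.eval b + k * (c - b)) := by
    rw [PowerSeries.isUnit_iff_constantCoeff]
    have := hunit b hba
    rw [PowerSeries.isUnit_iff_constantCoeff] at this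
    simpa [hc.2, hba] using this
  exact sub_eq_zero.1 (hu.mul_right_eq_zero.1 h)

theorem eval_derivative_prod_X_sub_C {ι : Type*} [Fintype ι] [DecidableEq ι] (r : ι → R) (i : ι) :
    (∏ j, (Polynomial.X - Polynomial.C (r j))).derivative.eval (r i) =
      ∏ j ∈ Finset.univ.erase i, (r i - r j) := by
  rw [← Finset.mul_prod_erase _ _ (Finset.mem_univ i), Polynomial.derivative_mul]
  simp [Polynomial.eval_prod]

variable {n : Type*} [Fintype n] [DecidableEq n]

/-- A pencil of matrices of power series whose leading term is congruent to
`diag (r i * f i) - μ * diag (f i)` has a unique root over each `r i`. -/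
theorem existsUnique_root_det_sub_smul (S₁ S₂ : Matrix n n (PowerSeries R)) (J : Matrix n n R)
    (r f : n → R) (hJ : IsUnit J.det) (hf : ∀ i, IsUnit (f i))
    (hr : ∀ i j, i ≠ j → IsUnit (r i - r j))
    (h₁ : J * S₁.map PowerSeries.constantCoeff * J.transpose = Matrix.diagonal f)
    (h₂ : J * S₂.map PowerSeries.constantCoeff * J.transpose =
      Matrix.diagonal fun i => r i * f i) (i : n) :
    ∃! μ : PowerSeries R, (S₂ - μ • S₁).det = 0 ∧ PowerSeries.constantCoeff μ = r i := by
  set G₁ := S₁.map PowerSeries.constantCoeff with hG₁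
  set G₂ := S₂.map PowerSeries.constantCoeff with hG₂
  have hdetG : IsUnit G₁.det := by
    have h := congrArg Matrix.det h₁
    rw [Matrix.det_mul, Matrix.det_mul, Matrix.det_transpose, Matrix.det_diagonal] at h
    have hu : IsUnit (J.det * G₁.det * J.det) := h ▸ IsUnit.prod_univ_iff.2 hf
    exact isUnit_of_mul_isUnit_right (isUnit_of_mul_isUnit_left hu)
  have hdetS : IsUnit S₁.det := by
    rw [PowerSeries.isUnit_iff_constantCoeff, RingHom.map_det]
    exact hdetG
  set M := S₁⁻¹ * S₂ with hM
  -- Since `S₁` is invertible, the pencil can be replaced by the monic characteristic polynomial of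
  -- `S₁⁻¹ S₂`, to which Hensel's lemma applies.
  have hroot : ∀ μ : PowerSeries R, (S₂ - μ • S₁).det = 0 ↔ M.charpoly.IsRoot μ := fun μ => by
    have h : S₂ - μ • S₁ = S₁ * -(Matrix.scalar n μ - M) := by
      rw [neg_sub, mul_sub, hM, Matrix.mul_nonsing_inv_cancel_left _ _ hdetS,
        ← Matrix.scalar_commute _ (Commute.all _), Matrix.scalar_apply, ← Matrix.smul_eq_diagonal_mul]
    rw [h, Matrix.det_mul, hdetS.mul_right_eq_zero, Matrix.det_neg, Polynomial.IsRoot,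
      Matrix.eval_charpoly]
    exact ((isUnit_one.neg).pow _).mul_right_eq_zero
  simp only [hroot]
  -- At `ε = 0` both sides of `J G₁ M Jᵀ = J G₁ Jᵀ diag(r)` equal `diag(r f)`; cancelling `J G₁`
  -- diagonalises `M`.
  have hdiag : M.map PowerSeries.constantCoeff = J.transpose * Matrix.diagonal r * J.transpose⁻¹ := by
    have hJt : IsUnit J.transpose.det := by rwa [Matrix.det_transpose]
    have hGM : G₁ * M.map PowerSeries.constantCoeff = G₂ := by
      rw [hG₁, ← Matrix.map_mul, hM, Matrix.mul_nonsing_inv_cancel_left _ _ hdetS]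
    have key : (J * G₁) * (M.map PowerSeries.constantCoeff * J.transpose) =
        (J * G₁) * (J.transpose * Matrix.diagonal r) := by
      rw [← mul_assoc, mul_assoc J, hGM, h₂, ← mul_assoc, h₁, Matrix.diagonal_mul_diagonal]
      simp only [mul_comm]
    have hu : IsUnit (J * G₁).det := by rw [Matrix.det_mul]; exact hJ.mul hdetG
    have := congrArg (fun A => (J * G₁)⁻¹ * A * J.transpose⁻¹) key
    simp only [Matrix.nonsing_inv_mul_cancel_left _ _ hu] at this
    rwa [Matrix.mul_nonsing_inv_cancel_right _ _ hJt] at this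
  have hchar : M.charpoly.map PowerSeries.constantCoeff =
      ∏ j, (Polynomial.X - Polynomial.C (r j)) := by
    rw [← Matrix.charpoly_map, hdiag, ← Matrix.charpoly_diagonal r]
    have hJt : IsUnit J.transpose.det := by rwa [Matrix.det_transpose]
    exact Matrix.charpoly_units_conj (Matrix.nonsingInvUnit _ hJt) (Matrix.diagonal r)
  refine existsUnique_root_of_simple M.charpoly_monic (r i) ?_ ?_
  · rw [hchar, Polynomial.eval_prod]
    exact Finset.prod_eq_zero (Finset.mem_univ i) (by simp)
  · rw [hchar, eval_derivative_prod_X_sub_C]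
    exact IsUnit.prod_iff.2 fun j hj => hr i j (Finset.ne_of_mem_erase hj).symm

end FormalRoots

/-! ### The symbol calculus -/

section Symbol

variable {N : ℕ} {U : Opens (Fin N → ℝ)}

theorem base_zero : base (0 : DiffPoly U) = 0 := map_zero MvPolynomial.constantCoeff

theorem base_add (f g : DiffPoly U) : base (f + g) = base f + base g :=
  map_add MvPolynomial.constantCoeff f g

theorem base_mul (f g : DiffPoly U) : base (f * g) = base f * base g :=
  map_mul MvPolynomial.constantCoeff f g

/-- Every term of `∂_x` carries a factor `u^{i,σ+1}`. -/
theorem base_totalD (f : DiffPoly U) : base (totalD f) = 0 := by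
  simp [base, totalD]

theorem base_iterate_totalD (k : ℕ) (hk : k ≠ 0) (f : DiffPoly U) : base (totalD^[k] f) = 0 := by
  obtain ⟨k, rfl⟩ := Nat.exists_eq_succ_of_ne_zero hk
  rw [Function.iterate_succ_apply', base_totalD]

theorem iterate_totalD_zero (k : ℕ) : totalD^[k] (0 : DiffPoly U) = 0 := by
  induction k with
  | zero => rfl
  | succ k ih =>
    rw [Function.iterate_succ_apply', ih]
    simp [totalD, jetPd]

theorem pd_zero (i : Fin N) : pd i (0 : Smooth U) = 0 := by
  have h : extendZero (0 : U → ℝ) = 0 := by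
    funext x
    by_cases hx : x ∈ U
    · exact extendZero_of_mem _ hx
    · exact Function.extend_apply' _ _ _ (by rintro ⟨y, rfl⟩; exact hx y.2)
  refine Subtype.ext (funext fun x => ?_)
  change fderiv ℝ (extendZero (0 : U → ℝ)) x.1 (Pi.single i 1) = 0
  rw [h]
  simp

theorem base_jetPd_zero (i : Fin N) (f : DiffPoly U) : base (jetPd i 0 f) = pd i (base f) := by
  simp only [base, jetPd, map_sum, MvPolynomial.constantCoeff_monomial]
  rw [Finset.sum_ite_eq']
  split_ifs with h
  · rfl
  · rw [MvPolynomial.constantCoeff_eq, MvPolynomial.notMem_support_iff.1 h, pd_zero]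

/-- All jet variables have positive degree, so a jet-free term has degree zero. -/
theorem HasDegree.base_eq_zero {f : DiffPoly U} {d : ℕ} (hf : HasDegree f d) (hd : d ≠ 0) :
    base f = 0 :=
  MvPolynomial.IsWeightedHomogeneous.coeff_eq_zero hf 0 (by simpa using hd.symm)

theorem HasDegree.eq_C_base {f : DiffPoly U} (hf : HasDegree f 0) :
    f = MvPolynomial.C (base f) := by
  ext m
  rw [MvPolynomial.coeff_C]
  split_ifs with h
  · rw [← h]; rfl
  · by_contra hm
    have hw := hf hm
    apply h
    ext p
    by_contra hp
    have := Finsupp.le_weight (fun p : Fin N × ℕ => p.2 + 1) (s := p) (by simp) m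
    simp only [Finsupp.coe_zero, Pi.zero_apply] at hp
    omega

/-- For `s ≥ 1` the jet-free part is the coefficient of the linear monomial `u^{i,s}`, which has
degree `s`. -/
theorem HasDegree.base_jetPd {f : DiffPoly U} {n : ℕ} (hf : HasDegree f n) (i : Fin N) {s : ℕ}
    (hs : s ≠ n) : base (jetPd i s f) = 0 := by
  cases s with
  | zero => rw [base_jetPd_zero, hf.base_eq_zero hs.symm, pd_zero]
  | succ s =>
    simp only [base, jetPd, MvPolynomial.constantCoeff_eq, MvPolynomial.coeff_pderiv]
    rw [MvPolynomial.IsWeightedHomogeneous.coeff_eq_zero hf _ (by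
      simpa [Finsupp.weight_single] using hs), zero_mul]

/-- The reduction of the coefficients of a series in `ε` modulo the jet variables. -/
def baseEps : EpsPoly U →+* PowerSeries (Smooth U) := PowerSeries.map MvPolynomial.constantCoeff

theorem coeff_baseEps (f : EpsPoly U) (n : ℕ) :
    PowerSeries.coeff n (baseEps f) = base (PowerSeries.coeff n f) :=
  PowerSeries.coeff_map _ _ _

theorem baseEps_C (f : DiffPoly U) : baseEps (PowerSeries.C f) = PowerSeries.C (base f) :=
  PowerSeries.map_C _ _

theorem baseEps_epsD (f : EpsPoly U) : baseEps (epsD f) = 0 := by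
  ext1 n
  rw [coeff_baseEps, epsD, PowerSeries.coeff_mk, base_totalD, map_zero]

theorem baseEps_eq_C {f : EpsPoly U} (hf : ∀ k, HasDegree (PowerSeries.coeff k f) k) :
    baseEps f = PowerSeries.C (base (PowerSeries.coeff 0 f)) := by
  ext1 n
  rw [coeff_baseEps, PowerSeries.coeff_C]
  split_ifs with h
  · rw [h]
  · exact (hf n).base_eq_zero h

/-- The operator `A` has symbol `φ`, with offset `c` : after reduction modulo the jet variables,
`A` is `∑_n φ_n ε^n ∂_x^(n + c)`. -/
def HasSymbol (A : PDO U) (c : ℤ) (φ : PowerSeries (Smooth U)) : Prop :=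
  ∀ (n : ℕ) (m : ℤ), base (A.1 n m) = if m = n + c then PowerSeries.coeff n φ else 0

namespace HasSymbol

variable {A B : PDO U} {c c' : ℤ} {φ ψ : PowerSeries (Smooth U)}

theorem unique (hφ : HasSymbol A c φ) (hψ : HasSymbol A c ψ) : φ = ψ := by
  ext1 n
  simpa using (hφ n (n + c)).symm.trans (hψ n (n + c))

theorem congr (h : HasSymbol A c φ) (hc : c = c') (hφ : φ = ψ) : HasSymbol A c' ψ := hc ▸ hφ ▸ h

/-- The zero symbol fits every offset; this lets vanishing non-local terms be added to any operator.
-/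
theorem change_offset (h : HasSymbol A c 0) (c' : ℤ) : HasSymbol A c' 0 := fun n m => by
  simpa using h n m

theorem zero (c : ℤ) : HasSymbol (0 : PDO U) c 0 := fun n m => by
  simpa using base_zero (U := U)

theorem add (hA : HasSymbol A c φ) (hB : HasSymbol B c ψ) : HasSymbol (A + B) c (φ + ψ) :=
  fun n m => by
    change base (A.1 n m + B.1 n m) = _
    rw [base_add, hA, hB, map_add]
    split_ifs <;> simp

theorem neg (hA : HasSymbol A c φ) : HasSymbol (-A) c (-φ) := fun n m => by
  change MvPolynomial.constantCoeff (-A.1 n m) = _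
  rw [map_neg, map_neg]
  change -base (A.1 n m) = _
  rw [hA]
  split_ifs <;> simp

theorem sub (hA : HasSymbol A c φ) (hB : HasSymbol B c ψ) : HasSymbol (A - B) c (φ - ψ) := by
  rw [sub_eq_add_neg, sub_eq_add_neg]
  exact hA.add hB.neg

theorem sum {ι : Type*} (s : Finset ι) {A : ι → PDO U} {φ : ι → PowerSeries (Smooth U)}
    (h : ∀ i ∈ s, HasSymbol (A i) c (φ i)) : HasSymbol (∑ i ∈ s, A i) c (∑ i ∈ s, φ i) := by
  classical
  induction s using Finset.induction_on with
  | empty => simpa using zero c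
  | insert i s hi ih =>
    rw [Finset.sum_insert hi, Finset.sum_insert hi]
    exact (h i (Finset.mem_insert_self _ _)).add
      (ih fun j hj => h j (Finset.mem_insert_of_mem hj))

/-- The reduction `g ε^a ∂^0` has order `0 = a + c`, whence `c = -a`. -/
theorem ofFun {f : EpsPoly U} {a : ℕ} {g : Smooth U}
    (h : baseEps f = PowerSeries.monomial a g) :
    HasSymbol (PDO.ofFun f) (-a) (PowerSeries.monomial a g) := fun n m => by
  have hn := coeff_baseEps f n
  rw [h] at hn
  simp only [PDO.ofFun]
  rw [apply_ite base, base_zero, ← hn, PowerSeries.coeff_monomial]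
  split_ifs <;> first | rfl | omega

theorem ofFun_zero {f : EpsPoly U} (h : baseEps f = 0) (c : ℤ) : HasSymbol (PDO.ofFun f) c 0 := by
  have := ofFun (f := f) (a := 0) (g := 0) (by simpa using h)
  rw [map_zero] at this
  exact this.change_offset c

theorem ofFun_C {f : EpsPoly U} {g : Smooth U} (h : baseEps f = PowerSeries.C g) :
    HasSymbol (PDO.ofFun f) 0 (PowerSeries.C g) := by
  have := ofFun (f := f) (a := 0) (g := g) (by simpa using h)
  simpa using this

theorem dPow (k : ℤ) : HasSymbol (PDO.dPow U k) k 1 := fun n m => by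
  simp only [PDO.dPow]
  rw [apply_ite base, base_zero, PowerSeries.coeff_one]
  have h1 : base (1 : DiffPoly U) = 1 := map_one MvPolynomial.constantCoeff
  rw [h1]
  split_ifs <;> first | rfl | omega

theorem add_zero_right (hA : HasSymbol A c φ) (hB : HasSymbol B c 0) :
    HasSymbol (A + B) c φ :=
  (hA.add hB).congr rfl (add_zero φ)

/-- Leibniz terms with `k > 0` contain a total derivative and vanish; in the `k = 0` terms both the
powers of `ε` and the orders add. -/
theorem comp (hA : HasSymbol A c φ) (hB : HasSymbol B c' ψ) :
    HasSymbol (PDO.comp A B) (c + c') (φ * ψ) := fun n r => by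
  simp only [PDO.comp]
  change MvPolynomial.constantCoeff _ = _
  rw [map_sum, PowerSeries.coeff_mul]
  have key : ∀ p ∈ Finset.HasAntidiagonal.antidiagonal n,
      MvPolynomial.constantCoeff (∑ᶠ q : ℤ × ℕ,
        Ring.choose q.1 q.2 • (A.1 p.1 q.1 * totalD^[q.2] (B.1 p.2 (r - q.1 + q.2)))) =
      if r = n + (c + c') then PowerSeries.coeff p.1 φ * PowerSeries.coeff p.2 ψ else 0 := by
    intro p hp
    obtain ⟨Ma, hMa⟩ := A.2 p.1
    obtain ⟨Mb, hMb⟩ := B.2 p.2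
    -- The reduction commutes with `∑ᶠ` only for finite support, which the order bounds `Ma` and
    -- `Mb` provide.
    have hfin : Function.HasFiniteSupport fun q : ℤ × ℕ =>
        Ring.choose q.1 q.2 • (A.1 p.1 q.1 * totalD^[q.2] (B.1 p.2 (r - q.1 + q.2))) := by
      refine ((Set.finite_Icc (r - Mb) Ma).prod
        (Set.finite_Iic (Mb - r + Ma).toNat)).subset fun q hq => ?_
      by_contra hnot
      apply hq
      by_cases h : Ma < q.1
      · beta_reduce; rw [hMa _ h]; simp
      · have h2 : Mb < r - q.1 + q.2 := by
          by_contra h3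
          apply hnot
          simp only [Set.mem_prod, Set.mem_Icc, Set.mem_Iic]
          omega
        beta_reduce; rw [hMb _ h2, iterate_totalD_zero]; simp
    refine ((MvPolynomial.constantCoeff (R := Smooth U)).toAddMonoidHom.map_finsum hfin).trans ?_
    rw [finsum_eq_single _ ((p.1 : ℤ) + c, 0)]
    · have hsum : p.1 + p.2 = n := by simpa using hp
      change base (Ring.choose _ 0 • (A.1 p.1 _ * totalD^[0] (B.1 p.2 _))) = _
      rw [Ring.choose_zero_right, one_smul, base_mul, Function.iterate_zero_apply, hA, hB]
      simp only [if_true]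
      have hiff : r - (p.1 + c) + ((0 : ℕ) : ℤ) = p.2 + c' ↔ r = n + (c + c') := by omega
      simp only [hiff]
      split_ifs <;> simp
    · rintro ⟨q, k⟩ hq
      change MvPolynomial.constantCoeff _ = _
      rw [map_zsmul, map_mul]
      change _ • (base (A.1 p.1 q) * base (totalD^[k] _)) = 0
      by_cases hk : k = 0
      · rw [hA, if_neg fun h => hq (by rw [h, hk]), zero_mul, smul_zero]
      · rw [base_iterate_totalD k hk, mul_zero, smul_zero]
  rw [Finset.sum_congr rfl key]
  split_ifs <;> simp

/-- Only `k = 0` survives; its sign `(-1)^(n+c)` splits into `(-1)^c` and the substitution `ε ↦ -ε`.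
-/
theorem adjoint (hA : HasSymbol A c φ) :
    HasSymbol (PDO.adjoint A) c ((c.negOnePow : ℤ) • PowerSeries.rescale (-1) φ) := fun n r => by
  simp only [PDO.adjoint]
  obtain ⟨M, hM⟩ := A.2 n
  have hfin : Function.HasFiniteSupport fun k : ℕ =>
      (((r + k).negOnePow : ℤ) * Ring.choose (r + k) k) • totalD^[k] (A.1 n (r + k)) := by
    refine (Set.finite_Iic (M - r).toNat).subset fun k hk => ?_
    by_contra hnot
    apply hk
    have h : M < r + k := by
      simp only [Set.mem_Iic] at hnot
      omega
    beta_reduce; rw [hM _ h, iterate_totalD_zero, smul_zero]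
  refine ((MvPolynomial.constantCoeff (R := Smooth U)).toAddMonoidHom.map_finsum hfin).trans ?_
  rw [finsum_eq_single _ 0]
  · change MvPolynomial.constantCoeff _ = _
    rw [map_zsmul]
    change _ • base (A.1 n (r + (0 : ℕ))) = _
    rw [hA]
    simp only [Nat.cast_zero, add_zero, Ring.choose_zero_right, mul_one]
    split_ifs with h
    · rw [h, map_zsmul, PowerSeries.coeff_rescale, Int.negOnePow_add]
      simp [Int.negOnePow_def]
      ring
    · simp
  · intro k hk
    change MvPolynomial.constantCoeff _ = _
    rw [map_zsmul]
    change _ • base (totalD^[k] _) = 0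
    rw [base_iterate_totalD k hk, smul_zero]

theorem frechet {F : EpsPoly U} (hF : ∀ k, HasDegree (PowerSeries.coeff k F) k) (i : Fin N) :
    HasSymbol (PDO.frechet F i) 0
      (PowerSeries.mk fun n => base (jetPd i n (PowerSeries.coeff n F))) := fun n m => by
  simp only [PDO.frechet]
  rw [apply_ite base, base_zero, PowerSeries.coeff_mk, add_zero]
  split_ifs with h1 h2 h2
  · rw [h2, Int.toNat_natCast]
  · exact (hF n).base_jetPd i (by omega)
  · omega
  · rfl

end HasSymbol

end Symbol

/-! ### Smooth functions -/

section SmoothFunctions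

variable {N : ℕ} {U W : Opens (Fin N → ℝ)}

theorem Smooth.ext {f g : Smooth U} (h : ∀ x, f x = g x) : f = g := Subtype.ext (funext h)

/-- Evaluation at a point of `U`. -/
def Smooth.ev (x : U) : Smooth U →+* ℝ where
  toFun f := f x
  map_one' := rfl
  map_mul' _ _ := rfl
  map_zero' := rfl
  map_add' _ _ := rfl

theorem Smooth.ev_apply (x : U) (f : Smooth U) : Smooth.ev x f = f x := rfl

theorem Smooth.isUnit {f : Smooth U} (hf : ∀ x, f x ≠ 0) : IsUnit f := by
  refine IsUnit.of_mul_eq_one ⟨fun x => (f x)⁻¹, ?_⟩ (Smooth.ext fun x => mul_inv_cancel₀ (hf x))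
  refine (ContDiffOn.inv f.2 fun x hx => ?_).congr fun x hx => ?_
  · rw [extendZero_of_mem _ (show x ∈ U from hx)]
    exact hf _
  · rw [Pi.inv_apply, extendZero_of_mem _ (show x ∈ U from hx),
      extendZero_of_mem _ (show x ∈ U from hx)]

theorem Smooth.hasFDerivAt (f : Smooth U) (x : U) :
    HasFDerivAt (extendZero f.1) (fderiv ℝ (extendZero f.1) x.1) x.1 :=
  ((f.2.contDiffAt (U.isOpen.mem_nhds x.2)).differentiableAt (by simp)).hasFDerivAt

theorem Smooth.continuous (f : Smooth U) : Continuous f.1 := by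
  have h : f.1 = fun x : U => extendZero f.1 x.1 := funext fun x => (extendZero_apply f.1 x).symm
  rw [h]
  exact f.2.continuousOn.comp_continuous continuous_subtype_val fun x => x.2

/-- The Jacobian matrix of a family of smooth functions. -/
def jacobian (r : Fin N → Smooth U) : Matrix (Fin N) (Fin N) (Smooth U) :=
  Matrix.of fun i j => pd j (r i)

theorem isUnit_det_jacobian {r : Fin N → Smooth U}
    (h : ∀ x, Matrix.det (Matrix.of fun i j => pd j (r i) x) ≠ 0) : IsUnit (jacobian r).det :=
  Smooth.isUnit fun x => by
    rw [← Smooth.ev_apply, RingHom.map_det]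
    exact h x

/-- Composition with `K` as a ring homomorphism. -/
def Smooth.pullHom (K : U → W) (hK : ∀ i, (fun x => (K x).1 i) ∈ smoothSubalgebra U) :
    Smooth W →+* Smooth U where
  toFun := Smooth.pull K hK
  map_one' := rfl
  map_mul' _ _ := rfl
  map_zero' := rfl
  map_add' _ _ := rfl

variable (K : U → W)

theorem hasFDerivAt_extendZero_pi (hK : ∀ i, (fun x => (K x).1 i) ∈ smoothSubalgebra U) (x : U) :
    HasFDerivAt (fun y i => extendZero (fun x => (K x).1 i) y)
      (ContinuousLinearMap.pi fun i => fderiv ℝ (extendZero fun x => (K x).1 i) x.1) x.1 :=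
  hasFDerivAt_pi.2 fun i => Smooth.hasFDerivAt ⟨_, hK i⟩ x

/-- The chain rule. -/
theorem pd_pull (hK : ∀ i, (fun x => (K x).1 i) ∈ smoothSubalgebra U)
    (F : Smooth W) (j : Fin N) :
    pd j (Smooth.pull K hK F) =
      ∑ i, Smooth.pull K hK (pd i F) * pd j (⟨fun x => (K x).1 i, hK i⟩ : Smooth U) := by
  refine Smooth.ext fun x => ?_
  rw [← Smooth.ev_apply x (∑ i, _), map_sum]
  have hval : (fun i => extendZero (fun x => (K x).1 i) x.1) = (K x).1 :=
    funext fun i => extendZero_apply _ _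
  have h1 := hasFDerivAt_extendZero_pi K hK x
  have h2 : HasFDerivAt (extendZero F.1) (fderiv ℝ (extendZero F.1) (K x).1)
      ((fun y i => extendZero (fun x => (K x).1 i) y) x.1) := by
    beta_reduce
    rw [hval]
    exact F.hasFDerivAt (K x)
  have h3 := (h2.comp x.1 h1).congr_of_eventuallyEq (f₁ := extendZero (Smooth.pull K hK F).1) (by
    filter_upwards [U.isOpen.mem_nhds x.2] with y hy
    rw [extendZero_of_mem _ hy, Function.comp_apply]
    have : (fun i => extendZero (fun x => (K x).1 i) y) = (K ⟨y, hy⟩).1 :=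
      funext fun i => extendZero_of_mem _ hy
    rw [this, extendZero_apply]
    rfl)
  change fderiv ℝ (extendZero (Smooth.pull K hK F).1) x.1 (Pi.single j 1) = _
  rw [h3.fderiv, ContinuousLinearMap.comp_apply, ← ContinuousLinearMap.coe_coe,
    LinearMap.pi_apply_eq_sum_univ]
  refine Finset.sum_congr rfl fun i _ => ?_
  rw [smul_eq_mul, mul_comm]
  congr 1
  change fderiv ℝ (extendZero F.1) (K x).1 _ = fderiv ℝ (extendZero F.1) (K x).1 _
  congr 1
  funext k
  rw [Pi.single_apply]
  exact if_congr eq_comm rfl rfl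

theorem jacobian_pull (hK : ∀ i, (fun x => (K x).1 i) ∈ smoothSubalgebra U)
    (r : Fin N → Smooth W) :
    jacobian (fun i => Smooth.pull K hK (r i)) =
      (jacobian r).map (Smooth.pullHom K hK) *
        jacobian fun i => (⟨fun x => (K x).1 i, hK i⟩ : Smooth U) := by
  ext1 i j
  exact pd_pull K hK (r i) j

/-- By the inverse function theorem the inverse of `K` is smooth, so `F = f ∘ K⁻¹` is too. -/
theorem exists_pull_eq (hK : ∀ i, (fun x => (K x).1 i) ∈ smoothSubalgebra U)
    (hbij : Function.Bijective K)
    (hdet : ∀ x, Matrix.det (Matrix.of fun i j =>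
      pd j (⟨fun x => (K x).1 i, hK i⟩ : Smooth U) x) ≠ 0) (f : Smooth U) :
    ∃ F : Smooth W, Smooth.pull K hK F = f := by
  obtain ⟨L, hLK, hKL⟩ := Function.bijective_iff_has_inverse.1 hbij
  refine ⟨⟨fun y => f (L y), fun y hy => ContDiffAt.contDiffWithinAt ?_⟩,
    Smooth.ext fun x => congrArg f.1 (hLK x)⟩
  obtain ⟨x, rfl⟩ : ∃ x, (K x).1 = y := ⟨L ⟨y, hy⟩, congrArg Subtype.val (hKL ⟨y, hy⟩)⟩
  set k : (Fin N → ℝ) → Fin N → ℝ := fun y i => extendZero (fun x => (K x).1 i) y with hk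
  have hkU : ∀ y (hy : y ∈ U), k y = (K ⟨y, hy⟩).1 := fun y hy =>
    funext fun i => extendZero_of_mem _ hy
  have hsmooth : ContDiffAt ℝ ∞ k x.1 :=
    contDiffAt_pi.2 fun i => (hK i).contDiffAt (U.isOpen.mem_nhds x.2)
  set A := ContinuousLinearMap.pi fun i => fderiv ℝ (extendZero fun x => (K x).1 i) x.1 with hA
  have hAdet : IsUnit (LinearMap.det (A : (Fin N → ℝ) →ₗ[ℝ] Fin N → ℝ)) := by
    rw [← LinearMap.det_toMatrix', isUnit_iff_ne_zero]
    convert! hdet x using 2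
  let e : (Fin N → ℝ) ≃L[ℝ] (Fin N → ℝ) :=
    (LinearEquiv.ofIsUnitDet (f := (A : (Fin N → ℝ) →ₗ[ℝ] Fin N → ℝ))
      (v := Pi.basisFun ℝ (Fin N)) (v' := Pi.basisFun ℝ (Fin N)) (by
        rwa [LinearMap.det_toMatrix])).toContinuousLinearEquiv
  have hder : HasFDerivAt k (e : (Fin N → ℝ) →L[ℝ] Fin N → ℝ) x.1 := by
    convert! hasFDerivAt_extendZero_pi K hK x using 1
  have hn : (∞ : WithTop ℕ∞) ≠ 0 := by simp
  have hinv := hsmooth.to_localInverse hder hn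
  have hkx : k x.1 = (K x).1 := hkU x.1 x.2
  have himg : hsmooth.localInverse hder hn (k x.1) = x.1 := hsmooth.localInverse_apply_image hder hn
  have hcomp : ContDiffAt ℝ ∞ (extendZero f.1 ∘ hsmooth.localInverse hder hn) (K x).1 := by
    rw [← hkx]
    refine ContDiffAt.comp _ ?_ hinv
    rw [himg]
    exact f.2.contDiffAt (U.isOpen.mem_nhds x.2)
  refine hcomp.congr_of_eventuallyEq ?_
  have h1 : ∀ᶠ y in nhds (K x).1, hsmooth.localInverse hder hn y ∈ U := by
    rw [← hkx]
    refine hinv.continuousAt.eventually_mem ?_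
    rw [himg]
    exact U.isOpen.mem_nhds x.2
  have h2 : ∀ᶠ y in nhds (K x).1, k (hsmooth.localInverse hder hn y) = y := by
    rw [← hkx]
    exact (hsmooth.hasStrictFDerivAt' hder hn).eventually_right_inverse
  -- Near `K x` the analytic local inverse lands in `U` and is a right inverse of `K`, so by
  -- injectivity it is the set-theoretic inverse `L`.
  filter_upwards [h1, h2, W.isOpen.mem_nhds (K x).2] with y hy1 hy2 hy3
  rw [extendZero_of_mem _ hy3, Function.comp_apply, extendZero_of_mem _ hy1]
  refine congrArg f.1 (hbij.injective ?_)
  rw [hKL]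
  apply Subtype.ext
  rw [← hkU _ hy1, hy2]

end SmoothFunctions

/-! ### Symbols of bivectors -/

namespace Bivector

variable {N : ℕ} {U : Opens (Fin N → ℝ)} (P : Bivector U)

theorem hasSymbol_loc (i j : Fin N) : HasSymbol (P.loc i j) 1 (P.symbol i j) := fun n m => by
  simp only [symbol, Matrix.of_apply, PowerSeries.coeff_mk]
  split_ifs with h
  · rw [h]
  · by_cases hm : m < 0 ∨ n + 1 < m
    · rw [P.loc_eq_zero i j n m hm, base_zero]
    · obtain ⟨s, rfl⟩ := Int.eq_ofNat_of_zero_le (show 0 ≤ m by omega)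
      exact (P.loc_degree i j n s (by omega)).base_eq_zero (by omega)

theorem baseEps_tail (i : Fin N) : baseEps (P.tail i) = 0 := by
  ext1 n
  rw [coeff_baseEps, tail, PowerSeries.coeff_mk, (P.nonloc_degree n i).base_eq_zero (by omega),
    map_zero]

theorem hasSymbol_op (i j : Fin N) : HasSymbol (P.op i j) 1 (P.symbol i j) := by
  have hX : ∀ i : Fin N,
      baseEps (PowerSeries.C (MvPolynomial.X (i, 0) : DiffPoly U)) = 0 := fun i => by
    rw [baseEps_C]
    simp [base]
  -- Outer factors with zero symbol may take any offset; the choice `1` gives `1 + (-1) + 1 = 1`,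
  -- matching the local part.
  have h1 := (((HasSymbol.ofFun_zero (hX i) 1).comp (HasSymbol.dPow (-1))).comp
    (HasSymbol.ofFun_zero (P.baseEps_tail j) 1))
  have h2 := (((HasSymbol.ofFun_zero (P.baseEps_tail i) 1).comp (HasSymbol.dPow (-1))).comp
    (HasSymbol.ofFun_zero (hX j) 1))
  exact ((P.hasSymbol_loc i j).add_zero_right (h1.congr (by norm_num) (by simp))).add_zero_right
    (h2.congr (by norm_num) (by simp))

/-- At offset `1` the adjoint has symbol `-φ(-ε)`, and skew-adjointness identifies it with minus the
transposed entry. -/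
theorem symbol_map_rescale :
    P.symbol.map (PowerSeries.rescale (-1)) = P.symbol.transpose := by
  ext1 i j
  have h := (P.hasSymbol_loc i j).adjoint
  rw [P.skew] at h
  have := h.unique (P.hasSymbol_loc j i).neg
  simpa using this

theorem symbol_map_constantCoeff :
    P.symbol.map PowerSeries.constantCoeff = Matrix.of P.metric := by
  ext1 i j
  simp only [symbol, metric, Matrix.map_apply, Matrix.of_apply,
    ← PowerSeries.coeff_zero_eq_constantCoeff_apply, PowerSeries.coeff_mk]
  simp

end Bivector

/-! ### Roots of the characteristic polynomial and their parity -/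

namespace Pencil

variable {N : ℕ} {U : Opens (Fin N → ℝ)} (P : Pencil U)

theorem eval_charPoly (μ : PowerSeries (Smooth U)) :
    P.charPoly.eval μ = (P.snd.symbol - μ • P.fst.symbol).det := by
  rw [charPoly, ← Polynomial.coe_evalRingHom, RingHom.map_det]
  congr 1
  ext1 i j
  simp only [Polynomial.coe_evalRingHom, RingHom.mapMatrix_apply, Matrix.map_apply,
    Matrix.sub_apply, Matrix.smul_apply, smul_eq_mul, Polynomial.eval_sub, Polynomial.eval_mul,
    Polynomial.eval_C, Polynomial.eval_X]

theorem sum_pd_mul_pd_eq_iff {g : Fin N → Fin N → Smooth U}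
    {r f : Fin N → Smooth U} :
    (∀ i j, ∑ k, ∑ l, pd k (r i) * g k l * pd l (r j) = if i = j then f i else 0) ↔
      jacobian r * Matrix.of g * (jacobian r).transpose = Matrix.diagonal f := by
  rw [← Matrix.ext_iff]
  refine forall_congr' fun i => forall_congr' fun j => ?_
  simp only [Matrix.mul_apply, Matrix.diagonal_apply, Finset.sum_mul, jacobian,
    Matrix.transpose_apply, Matrix.of_apply]
  rw [Finset.sum_comm]

theorem IsCanonical.existsUnique_root {P : Pencil U} {r f : Fin N → Smooth U}
    (h : P.IsCanonical r f) (i : Fin N) :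
    ∃! μ, P.charPoly.IsRoot μ ∧ PowerSeries.constantCoeff μ = r i := by
  simp only [Polynomial.IsRoot, eval_charPoly]
  refine existsUnique_root_det_sub_smul _ _ (MiuraReciprocal.jacobian r) r f (isUnit_det_jacobian h.jacobian)
    (fun i => Smooth.isUnit fun x => h.nondegenerate x i)
    (fun i j hij => Smooth.isUnit fun x => sub_ne_zero.2 (h.distinct x i j hij)) ?_ ?_ i
  · rw [P.fst.symbol_map_constantCoeff]
    exact sum_pd_mul_pd_eq_iff.1 h.fst_metric
  · rw [P.snd.symbol_map_constantCoeff]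
    exact sum_pd_mul_pd_eq_iff.1 h.snd_metric

/-- The substitution `ε ↦ -ε` transposes both symbols, which leaves the determinant unchanged. -/
theorem isRoot_rescale_neg_one {μ : PowerSeries (Smooth U)} (h : P.charPoly.IsRoot μ) :
    P.charPoly.IsRoot (PowerSeries.rescale (-1) μ) := by
  rw [Polynomial.IsRoot, eval_charPoly] at h ⊢
  have h' := congrArg (PowerSeries.rescale (-1)) h
  rw [RingHom.map_det, map_zero] at h'
  rw [← Matrix.det_transpose, ← h']
  congr 1
  rw [Matrix.transpose_sub, Matrix.transpose_smul, ← Bivector.symbol_map_rescale,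
    ← Bivector.symbol_map_rescale]
  ext1 i j
  simp

theorem IsCanonical.roots {P : Pencil U} {r f : Fin N → Smooth U} (h : P.IsCanonical r f) :
    ∃ lam, P.IsRootSystem r lam ∧ (∀ lam₁, P.IsRootSystem r lam₁ → lam₁ = lam) ∧
      ∀ i k, PowerSeries.coeff (2 * k + 1) (lam i) = 0 := by
  choose lam hlam huniq using h.existsUnique_root
  refine ⟨lam, hlam, fun lam₁ h₁ => funext fun i => huniq i _ (h₁ i), fun i k => ?_⟩
  -- `λ(-ε)` is again a root over `r i`, so uniqueness identifies it with `λ(ε)`.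
  have heven : PowerSeries.rescale (-1) (lam i) = lam i := by
    refine huniq i _ ⟨P.isRoot_rescale_neg_one (hlam i).1, ?_⟩
    rw [← PowerSeries.coeff_zero_eq_constantCoeff_apply, PowerSeries.coeff_rescale, pow_zero,
      one_mul, PowerSeries.coeff_zero_eq_constantCoeff_apply, (hlam i).2]
  have hk := congrArg (PowerSeries.coeff (2 * k + 1)) heven
  rw [PowerSeries.coeff_rescale, Odd.neg_one_pow ⟨k, rfl⟩, neg_one_mul] at hk
  refine Smooth.ext fun x => ?_
  have hx := congrArg (Smooth.ev x) hk
  rw [map_neg] at hx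
  change Smooth.ev x _ = 0
  linarith

end Pencil

/-! ### Symbols of transformations -/

namespace Transformation

variable {N : ℕ} {U W : Opens (Fin N → ℝ)} (T : Transformation U W)

/-- The function `H_0`. -/
def H₀ : Smooth U := base (PowerSeries.coeff 0 T.B)

theorem isUnit_H₀ : IsUnit T.H₀ := Smooth.isUnit T.H₀_ne_zero

/-- The function `1 / H_0`. -/
def H₀inv : Smooth U := Ring.inverse T.H₀

theorem H₀_mul_H₀inv : T.H₀ * T.H₀inv = 1 := Ring.mul_inverse_cancel _ T.isUnit_H₀

theorem baseEps_B : baseEps T.B = PowerSeries.C T.H₀ := baseEps_eq_C T.B_degree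

theorem isUnit_B : IsUnit T.B := by
  rw [PowerSeries.isUnit_iff_constantCoeff, ← PowerSeries.coeff_zero_eq_constantCoeff_apply,
    (T.B_degree 0).eq_C_base]
  exact T.isUnit_H₀.map MvPolynomial.C

theorem baseEps_Binv : baseEps T.Binv = PowerSeries.C T.H₀inv := by
  have h1 : baseEps T.B * baseEps T.Binv = 1 := by
    rw [← map_mul, Binv, Ring.mul_inverse_cancel _ T.isUnit_B, map_one]
  have h2 : PowerSeries.C T.H₀ * PowerSeries.C T.H₀inv = 1 := by
    rw [← map_mul, T.H₀_mul_H₀inv, map_one]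
  rw [T.baseEps_B] at h1
  exact left_inv_eq_right_inv (by rw [mul_comm]; exact h1) h2

theorem baseEps_jet (i : Fin N) (τ : ℕ) : baseEps (T.jet i (τ + 1)) = 0 := by
  rw [jet, Function.iterate_succ_apply', map_mul, baseEps_epsD, mul_zero]

/-- Composition with `K_0`. -/
def pullHom : Smooth W →+* Smooth U := Smooth.pullHom T.K₀ T.K₀_smooth

/-- The coefficients of `Q - K_0` have positive degree or vanish, so only the Taylor term `l = 0`
survives. -/
theorem baseEps_substSmooth (F : Smooth W) :
    baseEps (T.substSmooth F) = PowerSeries.C (T.pullHom F) := by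
  have hQ : ∀ i, baseEps (T.Q i -
      PowerSeries.C (MvPolynomial.C (base (PowerSeries.coeff 0 (T.Q i))))) = 0 := fun i => by
    rw [map_sub, baseEps_eq_C (T.Q_degree i), baseEps_C]
    simp [base]
  ext1 n
  rw [coeff_baseEps, substSmooth, PowerSeries.coeff_mk, base, map_sum, Finset.sum_range_succ']
  rw [Finset.sum_eq_zero, zero_add]
  · rw [map_sum, Fintype.sum_unique, map_mul, MvPolynomial.constantCoeff_C]
    have h : ∀ m : ℕ, MvPolynomial.constantCoeff (PowerSeries.coeff m (1 : EpsPoly U)) =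
        PowerSeries.coeff m (1 : PowerSeries (Smooth U)) := fun m => by
      rw [← PowerSeries.coeff_map, map_one]
    simp only [Finset.univ_eq_empty, Finset.prod_empty, h, List.ofFn_zero, pdList, List.foldr_nil,
      Nat.factorial_zero, Nat.cast_one, inv_one, one_smul]
    rw [PowerSeries.coeff_one, PowerSeries.coeff_C]
    split_ifs
    · rw [mul_one]; rfl
    · rw [mul_zero]
  · intro l _
    rw [map_sum]
    refine Finset.sum_eq_zero fun s _ => ?_
    rw [map_mul]
    refine mul_eq_zero_of_right _ ((coeff_baseEps _ n).symm.trans ?_)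
    rw [map_prod, Fin.prod_univ_succ, hQ, zero_mul, map_zero]

/-- For `τ ≥ 1`, `w^{i,τ}` is a multiple of a total derivative, so only the jet-free monomial
contributes. -/
theorem baseEps_subst (f : DiffPoly W) :
    baseEps (T.subst f) = PowerSeries.C (T.pullHom (base f)) := by
  rw [subst, map_sum, Finset.sum_eq_single 0]
  · rw [Finsupp.prod_zero_index, mul_one, T.baseEps_substSmooth]
    rfl
  · intro m _ hm
    obtain ⟨p, hp⟩ := Finsupp.support_nonempty_iff.2 hm
    rw [map_mul, Finsupp.prod, map_prod, Finset.prod_eq_zero hp, mul_zero]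
    rw [map_pow, T.baseEps_jet, zero_pow (Finsupp.mem_support_iff.1 hp)]
  · intro h
    rw [MvPolynomial.notMem_support_iff.1 h, map_mul, T.baseEps_substSmooth, map_zero, map_zero,
      zero_mul]

theorem baseEps_substEps {f : EpsPoly W} (hf : baseEps f = 0) : baseEps (T.substEps f) = 0 := by
  ext1 n
  rw [coeff_baseEps, substEps, PowerSeries.coeff_mk, base, map_sum, map_zero]
  refine Finset.sum_eq_zero fun p _ => ?_
  refine (coeff_baseEps _ _).symm.trans ?_
  rw [T.baseEps_subst, ← coeff_baseEps, hf, map_zero, map_zero, map_zero, map_zero]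

theorem hasSymbol_dyPow (s : ℕ) :
    HasSymbol (T.dyPow s) s (PowerSeries.C (T.H₀inv ^ s)) := by
  induction s with
  | zero =>
    rw [pow_zero]
    exact HasSymbol.ofFun_C (by rw [map_one, map_one])
  | succ s ih =>
    have h := ((HasSymbol.ofFun_C T.baseEps_Binv).comp (HasSymbol.dPow 1)).comp ih
    rw [mul_one, ← map_mul, ← pow_succ', zero_add, add_comm] at h
    exact_mod_cast h

/-- The action on symbols of the change of coordinates: `ε` is rescaled by `1 / H_0`. -/
def symbolHom : PowerSeries (Smooth W) →+* PowerSeries (Smooth U) :=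
  (PowerSeries.rescale T.H₀inv).comp (PowerSeries.map T.pullHom)

theorem coeff_symbolHom (n : ℕ) (φ : PowerSeries (Smooth W)) :
    PowerSeries.coeff n (T.symbolHom φ) = T.H₀inv ^ n * T.pullHom (PowerSeries.coeff n φ) := by
  rw [symbolHom, RingHom.comp_apply, PowerSeries.coeff_rescale, PowerSeries.coeff_map]

theorem constantCoeff_symbolHom (φ : PowerSeries (Smooth W)) :
    PowerSeries.constantCoeff (T.symbolHom φ) = T.pullHom (PowerSeries.constantCoeff φ) := by
  simpa using T.coeff_symbolHom 0 φ

/-- `ε^a ∂_y^(a+1)` reduces to `H_0^(-a-1) ε^a ∂_x^(a+1)`: one factor `1 / H_0` stands in front and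
the other `a` rescale `ε`. -/
theorem hasSymbol_pullLoc (P : Bivector W) (i j : Fin N) :
    HasSymbol (T.pullLoc P i j) 1 (PowerSeries.C T.H₀inv * T.symbolHom (P.symbol i j)) := by
  have hterm : ∀ a s : ℕ, s ∈ Finset.range (a + 2) →
      HasSymbol (PDO.ofFun (PowerSeries.X ^ a * T.subst ((P.loc i j).1 a s)) ⊚ T.dyPow s) 1
        (if s = a + 1 then PowerSeries.monomial a
          (T.H₀inv ^ (a + 1) * T.pullHom (PowerSeries.coeff a (P.symbol i j))) else 0) := by
    intro a s _
    have hb : baseEps (PowerSeries.X ^ a * T.subst ((P.loc i j).1 a s)) =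
        PowerSeries.monomial a (T.pullHom (base ((P.loc i j).1 a s))) := by
      have hX : baseEps (PowerSeries.X : EpsPoly U) = PowerSeries.X := PowerSeries.map_X _
      rw [map_mul, T.baseEps_subst, map_pow, hX, mul_comm, ← PowerSeries.monomial_eq_C_mul_X_pow]
    have h := (HasSymbol.ofFun hb).comp (T.hasSymbol_dyPow s)
    rw [P.hasSymbol_loc] at h
    split_ifs with hs
    · subst hs
      rw [if_pos (by push_cast; rfl)] at h
      convert! h using 1
      · push_cast; ring
      · rw [mul_comm _ (PowerSeries.C _), ← PowerSeries.smul_eq_C_mul, ← smul_eq_mul, map_smul]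
    · rw [if_neg (by omega), map_zero, map_zero, zero_mul] at h
      exact h.change_offset 1
  have htrunc : ∀ n, HasSymbol (T.pullLocTrunc P i j n) 1 (∑ a ∈ Finset.range (n + 1),
      PowerSeries.monomial a
        (T.H₀inv ^ (a + 1) * T.pullHom (PowerSeries.coeff a (P.symbol i j)))) := fun n => by
    refine HasSymbol.sum _ fun a _ => ?_
    have := HasSymbol.sum _ (hterm a)
    rwa [Finset.sum_ite_eq' (Finset.range (a + 2)), if_pos (by simp)] at this
  intro n m
  have h := htrunc n n m
  simp only [map_sum, PowerSeries.coeff_monomial] at h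
  rw [Finset.sum_ite_eq, if_pos (Finset.self_mem_range_succ n)] at h
  refine h.trans ?_
  rw [PowerSeries.coeff_C_mul, T.coeff_symbolHom, pow_succ', mul_assoc]

theorem hasSymbol_pull (P : Bivector W) (i j : Fin N) :
    HasSymbol (T.pull P i j) 1 (PowerSeries.C T.H₀inv * T.symbolHom (P.symbol i j)) := by
  have h1 := ((HasSymbol.ofFun_zero (T.baseEps_jet i 0) 1).comp (HasSymbol.dPow (-1))).comp
    (HasSymbol.ofFun_zero (f := T.B * T.substEps (P.tail j))
      (by rw [map_mul, T.baseEps_substEps (P.baseEps_tail j), mul_zero]) 1)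
  have h2 := ((HasSymbol.ofFun_zero (T.baseEps_substEps (P.baseEps_tail i)) 1).comp
    (HasSymbol.dPow (-1))).comp (HasSymbol.ofFun_zero (f := T.B * T.jet j 1)
      (by rw [map_mul, T.baseEps_jet, mul_zero]) 1)
  exact ((T.hasSymbol_pullLoc P i j).add_zero_right (h1.congr (by norm_num) (by simp))).add_zero_right
    (h2.congr (by norm_num) (by simp))

/-- The symbol of the Fréchet derivative of `Q`. -/
def frechetSymbol : Matrix (Fin N) (Fin N) (PowerSeries (Smooth U)) :=
  Matrix.of fun j i => PowerSeries.mk fun n => base (jetPd i n (PowerSeries.coeff n (T.Q j)))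

/-- The non-local summand begins with `∂_x Q^j`, which has no jet-free part. -/
theorem hasSymbol_D (j i : Fin N) :
    HasSymbol (T.D j i) 0 (PowerSeries.C T.H₀ * T.frechetSymbol j i) := by
  have h1 := (HasSymbol.ofFun_C T.baseEps_B).comp (HasSymbol.frechet (T.Q_degree j) i)
  have h2 := ((HasSymbol.ofFun_zero (baseEps_epsD (T.Q j)) 1).comp (HasSymbol.dPow (-1))).comp
    (HasSymbol.frechet T.B_degree i)
  exact ((h1.congr (add_zero 0) rfl).sub (h2.congr (c' := 0) (ψ := 0) (by norm_num)
    (by simp))).congr rfl (sub_zero _)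

/-- The Jacobian matrix of `K_0`. -/
def jacobianK₀ : Matrix (Fin N) (Fin N) (Smooth U) :=
  MiuraReciprocal.jacobian fun i => base (PowerSeries.coeff 0 (T.Q i))

theorem isUnit_det_jacobianK₀ : IsUnit T.jacobianK₀.det := isUnit_det_jacobian T.jacobian

theorem frechetSymbol_map_constantCoeff :
    T.frechetSymbol.map PowerSeries.constantCoeff = T.jacobianK₀ := by
  ext1 j i
  simp only [frechetSymbol, Matrix.map_apply, Matrix.of_apply,
    ← PowerSeries.coeff_zero_eq_constantCoeff_apply, PowerSeries.coeff_mk, base_jetPd_zero]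
  rfl

theorem isUnit_det_frechetSymbol : IsUnit T.frechetSymbol.det := by
  rw [PowerSeries.isUnit_iff_constantCoeff, RingHom.map_det]
  change IsUnit (T.frechetSymbol.map PowerSeries.constantCoeff).det
  rw [T.frechetSymbol_map_constantCoeff]
  exact T.isUnit_det_jacobianK₀

variable {T}

/-- The transformation law of the symbol. -/
theorem MapsBivector.symbol_map {P : Bivector U} {P' : Bivector W} (h : T.MapsBivector P P') :
    P'.symbol.map T.symbolHom = PowerSeries.C (T.H₀ ^ 2) • (T.frechetSymbol * P.symbol *
      (T.frechetSymbol.map (PowerSeries.rescale (-1))).transpose) := by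
  ext1 a b
  have hl := T.hasSymbol_pull P' a b
  rw [h a b] at hl
  have hr := (HasSymbol.ofFun_C T.baseEps_Binv).comp (HasSymbol.sum Finset.univ fun i _ =>
    HasSymbol.sum Finset.univ fun j _ =>
      ((T.hasSymbol_D a i).comp (P.hasSymbol_op i j)).comp (T.hasSymbol_D b j).adjoint)
  simp only [zero_add, add_zero, Int.negOnePow_zero, Units.val_one, one_smul, map_mul] at hr
  have heq := hl.unique hr
  have hC : ∀ g : Smooth U, PowerSeries.rescale (-1) (PowerSeries.C g) = PowerSeries.C g :=
    fun g => by
      ext1 n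
      rw [PowerSeries.coeff_rescale, PowerSeries.coeff_C]
      split_ifs with hn
      · rw [hn, pow_zero, one_mul]
      · rw [mul_zero]
  have hinv : PowerSeries.C T.H₀ * PowerSeries.C T.H₀inv = 1 := by
    rw [← map_mul, T.H₀_mul_H₀inv, map_one]
  -- Multiplying by `H_0` cancels the factor `1 / H_0` on both sides; the two operators `𝒟` leave
  -- `H_0²`.
  have heq' := congrArg (PowerSeries.C T.H₀ * ·) heq
  simp only [← mul_assoc, hinv, one_mul, hC] at heq'
  simp only [Matrix.map_apply, heq', Matrix.smul_apply, Matrix.mul_apply, Finset.sum_mul,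
    Matrix.transpose_apply, smul_eq_mul, Finset.mul_sum, map_pow]
  rw [Finset.sum_comm]
  refine Finset.sum_congr rfl fun j _ => Finset.sum_congr rfl fun i _ => ?_
  ring

/-- The transformation law of the metric. -/
theorem MapsBivector.metric_map {P : Bivector U} {P' : Bivector W} (h : T.MapsBivector P P') :
    (Matrix.of P'.metric).map T.pullHom = T.H₀ ^ 2 • (T.jacobianK₀ * Matrix.of P.metric *
      T.jacobianK₀.transpose) := by
  have hs := congrArg (fun M => M.map PowerSeries.constantCoeff) h.symbol_map
  simp only [Matrix.map_map] at hs
  rw [← P.symbol_map_constantCoeff, ← P'.symbol_map_constantCoeff,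
    ← T.frechetSymbol_map_constantCoeff]
  ext1 i j
  have hij := congrFun (congrFun hs i) j
  simp only [Matrix.map_apply, Function.comp_apply, constantCoeff_symbolHom] at hij
  simp only [Matrix.map_apply, hij, Matrix.smul_apply, Matrix.mul_apply, smul_eq_mul, map_mul,
    map_sum, PowerSeries.constantCoeff_C, Matrix.transpose_apply]
  have hcc : ∀ φ : PowerSeries (Smooth U),
      PowerSeries.constantCoeff (PowerSeries.rescale (-1) φ) = PowerSeries.constantCoeff φ :=
    fun φ => by
      rw [← PowerSeries.coeff_zero_eq_constantCoeff_apply, PowerSeries.coeff_rescale, pow_zero,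
        one_mul, PowerSeries.coeff_zero_eq_constantCoeff_apply]
  simp only [hcc]

/-- Both symbols transform with the same factors, all of unit determinant, so degeneracy of the
pencil at `μ` passes to `T.symbolHom μ`. -/
theorem MapsPencil.symbolHom_isRoot {P : Pencil U} {P' : Pencil W} (h : T.MapsPencil P P')
    {μ : PowerSeries (Smooth W)} (hμ : P'.charPoly.IsRoot μ) :
    P.charPoly.IsRoot (T.symbolHom μ) := by
  rw [Polynomial.IsRoot, Pencil.eval_charPoly] at hμ ⊢
  have h' := congrArg T.symbolHom hμ
  rw [RingHom.map_det, map_zero] at h'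
  have hmat : T.symbolHom.mapMatrix (P'.snd.symbol - μ • P'.fst.symbol) =
      PowerSeries.C (T.H₀ ^ 2) • (T.frechetSymbol *
        (P.snd.symbol - T.symbolHom μ • P.fst.symbol) *
        (T.frechetSymbol.map (PowerSeries.rescale (-1))).transpose) := by
    rw [mul_sub, sub_mul, smul_sub, ← h.2.symbol_map, Matrix.mul_smul, Matrix.smul_mul, smul_comm,
      ← h.1.symbol_map]
    ext1 i j
    simp
  have hu : IsUnit (T.frechetSymbol.map (PowerSeries.rescale (-1))).det := by
    have := T.isUnit_det_frechetSymbol.map (PowerSeries.rescale (-1 : Smooth U))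
    rwa [RingHom.map_det] at this
  rw [hmat, Matrix.det_smul, Matrix.det_mul, Matrix.det_mul, Matrix.det_transpose,
    (((T.isUnit_H₀.pow 2).map PowerSeries.C).pow _).mul_right_eq_zero, hu.mul_left_eq_zero,
    T.isUnit_det_frechetSymbol.mul_right_eq_zero] at h'
  exact h'

end Transformation

/-! ### Canonical coordinates of the image pencil -/

namespace Transformation

variable {N : ℕ} {U W : Opens (Fin N → ℝ)} (T : Transformation U W)

theorem bijective_K₀ : Function.Bijective T.K₀ := by
  have hval : ∀ x : U, (T.K₀ x).1 =
      (fun x i => extendZero (base (PowerSeries.coeff 0 (T.Q i))) x) x.1 := fun x =>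
    funext fun i => (extendZero_apply _ x).symm
  refine ⟨fun x y hxy => Subtype.ext (T.K₀_bijOn.injOn x.2 y.2 ?_), fun y => ?_⟩
  · exact (hval x).symm.trans ((congrArg Subtype.val hxy).trans (hval y))
  · obtain ⟨x, hx, hxy⟩ := T.K₀_bijOn.surjOn y.2
    exact ⟨⟨x, hx⟩, Subtype.ext ((hval ⟨x, hx⟩).trans hxy)⟩

theorem continuous_K₀ : Continuous T.K₀ :=
  Continuous.subtype_mk (continuous_pi fun i =>
    Smooth.continuous (base (PowerSeries.coeff 0 (T.Q i)))) _

theorem pullHom_injective : Function.Injective T.pullHom := fun F G h => Smooth.ext fun y => by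
  obtain ⟨x, rfl⟩ := T.bijective_K₀.surjective y
  exact congrArg (fun f : Smooth U => f x) h

theorem pullHom_surjective : Function.Surjective T.pullHom :=
  exists_pull_eq T.K₀ T.K₀_smooth T.bijective_K₀ T.jacobian

theorem jacobian_pullHom (r : Fin N → Smooth W) :
    MiuraReciprocal.jacobian (fun i => T.pullHom (r i)) =
      (MiuraReciprocal.jacobian r).map T.pullHom * T.jacobianK₀ :=
  jacobian_pull T.K₀ T.K₀_smooth r

variable {T}

theorem MapsBivector.metric_congruence_map {P : Bivector U} {P' : Bivector W}
    (h : T.MapsBivector P P') (r : Fin N → Smooth W) :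
    (MiuraReciprocal.jacobian r * Matrix.of P'.metric *
        (MiuraReciprocal.jacobian r).transpose).map T.pullHom =
      T.H₀ ^ 2 • (MiuraReciprocal.jacobian (fun i => T.pullHom (r i)) * Matrix.of P.metric *
        (MiuraReciprocal.jacobian fun i => T.pullHom (r i)).transpose) := by
  rw [Matrix.map_mul, Matrix.map_mul, h.metric_map, T.jacobian_pullHom, Matrix.transpose_mul,
    ← Matrix.transpose_map, Matrix.mul_smul, Matrix.smul_mul]
  simp only [Matrix.mul_assoc]

theorem MapsPencil.exists_isCanonical {P : Pencil U} {P' : Pencil W} (h : T.MapsPencil P P')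
    {r f : Fin N → Smooth U} (hr : P.IsCanonical r f) : ∃ r' f', P'.IsCanonical r' f' := by
  choose r' hr' using fun i => T.pullHom_surjective (r i)
  -- The factor `H_0²` is forced by the transformation law of the metric.
  choose f' hf' using fun i => T.pullHom_surjective (T.H₀ ^ 2 * f i)
  have hr'' : (fun i => T.pullHom (r' i)) = r := funext hr'
  have hmetric : ∀ {B : Bivector U} {B' : Bivector W} (_ : T.MapsBivector B B')
      {d : Fin N → Smooth U} {d' : Fin N → Smooth W} (_ : ∀ i, T.pullHom (d' i) = T.H₀ ^ 2 * d i)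
      (_ : ∀ i j, ∑ k, ∑ l, pd k (r i) * B.metric k l * pd l (r j) = if i = j then d i else 0)
      (i j : Fin N), ∑ k, ∑ l, pd k (r' i) * B'.metric k l * pd l (r' j) =
        if i = j then d' i else 0 := by
    intro B B' hB d d' hd hBr
    refine (Pencil.sum_pd_mul_pd_eq_iff (g := B'.metric)).2 ?_
    apply Matrix.map_injective T.pullHom_injective
    beta_reduce
    rw [hB.metric_congruence_map, hr'',
      (Pencil.sum_pd_mul_pd_eq_iff (g := B.metric)).1 hBr,
      Matrix.diagonal_map (map_zero _), ← Matrix.diagonal_smul]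
    exact congrArg Matrix.diagonal (funext fun i => (hd i).symm)
  refine ⟨r', f', ⟨fun y hy => ?_, fun y i j hij hy => ?_, fun y i hy => ?_,
    hmetric h.1 hf' hr.fst_metric, hmetric h.2 (fun i => ?_) hr.snd_metric⟩⟩
  · obtain ⟨x, rfl⟩ := T.bijective_K₀.surjective y
    apply hr.jacobian x
    have hdet : (MiuraReciprocal.jacobian r).det =
        T.pullHom (MiuraReciprocal.jacobian r').det * T.jacobianK₀.det := by
      rw [← hr'', T.jacobian_pullHom, Matrix.det_mul, RingHom.map_det]
      rfl
    have hx := congrArg (Smooth.ev x) hdet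
    have h0 : Smooth.ev x (T.pullHom (MiuraReciprocal.jacobian r').det) = 0 := by
      change Smooth.ev (T.K₀ x) (MiuraReciprocal.jacobian r').det = 0
      rw [RingHom.map_det]
      exact hy
    rw [map_mul, h0, zero_mul, RingHom.map_det] at hx
    exact hx
  · obtain ⟨x, rfl⟩ := T.bijective_K₀.surjective y
    apply hr.distinct x i j hij
    rw [← hr' i, ← hr' j]
    exact hy
  · obtain ⟨x, rfl⟩ := T.bijective_K₀.surjective y
    have hx := congrArg (Smooth.ev x) (hf' i)
    rw [map_mul, map_pow] at hx
    exact mul_ne_zero (pow_ne_zero 2 (T.H₀_ne_zero x)) (hr.nondegenerate x i) (hx.symm.trans hy)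
  · rw [map_mul, hr', hf']
    ring

/-- The metric pencil is degenerate at `λ = r i`. In the coordinates `r'` this becomes the vanishing
of a product of real numbers at `x`, hence of one factor; the index found may depend on `x`. -/
theorem MapsPencil.exists_canonical_eq {P : Pencil U} {P' : Pencil W} (h : T.MapsPencil P P')
    {r f : Fin N → Smooth U} (hr : P.IsCanonical r f) {r' f' : Fin N → Smooth W}
    (hr' : P'.IsCanonical r' f') (i : Fin N) (x : U) : ∃ j, r' j (T.K₀ x) = r i x := by
  set J := MiuraReciprocal.jacobian r
  have hdet : (Matrix.of P.snd.metric - r i • Matrix.of P.fst.metric).det = 0 := by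
    have hconj : J * (Matrix.of P.snd.metric - r i • Matrix.of P.fst.metric) * J.transpose =
        Matrix.diagonal fun j => (r j - r i) * f j := by
      rw [mul_sub, sub_mul, (Pencil.sum_pd_mul_pd_eq_iff (g := P.snd.metric)).1 hr.snd_metric,
        Matrix.mul_smul, Matrix.smul_mul,
        (Pencil.sum_pd_mul_pd_eq_iff (g := P.fst.metric)).1 hr.fst_metric,
        ← Matrix.diagonal_smul, Matrix.diagonal_sub]
      exact congrArg Matrix.diagonal (funext fun j => (sub_mul _ _ _).symm)
    have hd := congrArg Matrix.det hconj
    have hu : IsUnit J.det := isUnit_det_jacobian hr.jacobian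
    rw [Matrix.det_mul, Matrix.det_mul, Matrix.det_transpose, Matrix.det_diagonal,
      Finset.prod_eq_zero (Finset.mem_univ i) (by rw [sub_self, zero_mul]),
      hu.mul_left_eq_zero, hu.mul_right_eq_zero] at hd
    exact hd
  have hconj : T.H₀ ^ 2 • (MiuraReciprocal.jacobian (fun i => T.pullHom (r' i)) *
      (Matrix.of P.snd.metric - r i • Matrix.of P.fst.metric) *
        (MiuraReciprocal.jacobian fun i => T.pullHom (r' i)).transpose) =
      Matrix.diagonal fun j => (T.pullHom (r' j) - r i) * T.pullHom (f' j) := by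
    rw [mul_sub, sub_mul, smul_sub, ← h.2.metric_congruence_map, Matrix.mul_smul, Matrix.smul_mul,
      smul_comm, ← h.1.metric_congruence_map,
      (Pencil.sum_pd_mul_pd_eq_iff (g := P'.snd.metric)).1 hr'.snd_metric,
      (Pencil.sum_pd_mul_pd_eq_iff (g := P'.fst.metric)).1 hr'.fst_metric,
      Matrix.diagonal_map (map_zero _), Matrix.diagonal_map (map_zero _),
      ← Matrix.diagonal_smul, Matrix.diagonal_sub]
    refine congrArg Matrix.diagonal (funext fun j => ?_)
    simp [sub_mul]
  have hd := congrArg Matrix.det hconj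
  rw [Matrix.det_smul, Matrix.det_mul, Matrix.det_mul, hdet, mul_zero, zero_mul, mul_zero,
    Matrix.det_diagonal] at hd
  have hx := congrArg (Smooth.ev x) hd
  rw [map_zero, map_prod] at hx
  obtain ⟨j, -, hj⟩ := Finset.prod_eq_zero_iff.1 hx.symm
  rw [map_mul, map_sub] at hj
  exact ⟨j, sub_eq_zero.1 ((mul_eq_zero.1 hj).resolve_right (hr'.nondegenerate (T.K₀ x) j))⟩

end Transformation

/-- Two families of continuous functions on a preconnected space, the first of which separates
indices and takes its values among those of the second, differ by a permutation. -/
theorem exists_perm_eq_of_preconnected {ι X : Type*} [Finite ι] [TopologicalSpace X]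
    [PreconnectedSpace X] {a b : ι → X → ℝ} (ha : ∀ i, Continuous (a i))
    (hb : ∀ i, Continuous (b i)) (hane : ∀ x i j, i ≠ j → a i x ≠ a j x)
    (hbne : ∀ x i j, i ≠ j → b i x ≠ b j x) (h : ∀ i x, ∃ j, b j x = a i x) :
    ∃ σ : Equiv.Perm ι, ∀ i x, b (σ i) x = a i x := by
  rcases isEmpty_or_nonempty X with hX | ⟨⟨x₀⟩⟩
  · exact ⟨1, fun _ x => hX.elim x⟩
  choose s hs using fun i => h i x₀
  have hinj : Function.Injective s := fun i j hij => by
    by_contra hne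
    exact hane x₀ i j hne (by rw [← hs i, ← hs j, hij])
  refine ⟨Equiv.ofBijective s (Finite.injective_iff_bijective.1 hinj), fun i x => ?_⟩
  have hclosed : ∀ j, IsClosed {x | b j x = a i x} := fun j => isClosed_eq (hb j) (ha i)
  -- The coincidence sets for the finitely many `j` are closed, disjoint and cover the space, so
  -- each is also open.
  have hopen : IsOpen {x | b (s i) x = a i x} := by
    have : {x | b (s i) x = a i x} = (⋃ j ∈ {j | j ≠ s i}, {x | b j x = a i x})ᶜ := by
      ext y
      simp only [Set.mem_ofPred_eq, Set.mem_compl_iff, Set.mem_iUnion, not_exists]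
      refine ⟨fun hy j hj hjy => hbne y j (s i) hj (hjy.trans hy.symm), fun hy => ?_⟩
      obtain ⟨j, hj⟩ := h i y
      by_contra hne
      exact hy j (fun hjs => hne (hjs ▸ hj)) hj
    rw [this]
    exact ((Set.toFinite _).isClosed_biUnion fun j _ => hclosed j).isOpen_compl
  exact (IsClopen.eq_univ ⟨hclosed _, hopen⟩ ⟨x₀, hs i⟩).ge (Set.mem_univ x)

/-! ### Matching of the canonical coordinates and invariance -/

namespace Transformation

variable {N : ℕ} {U W : Opens (Fin N → ℝ)} {T : Transformation U W}

theorem MapsPencil.exists_perm {P : Pencil U} {P' : Pencil W} (h : T.MapsPencil P P')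
    (hU : IsPreconnected (U : Set (Fin N → ℝ))) {r f : Fin N → Smooth U}
    (hr : P.IsCanonical r f) {r' f' : Fin N → Smooth W} (hr' : P'.IsCanonical r' f') :
    ∃ σ : Equiv.Perm (Fin N), ∀ i, T.pullHom (r' (σ i)) = r i := by
  have : PreconnectedSpace U := Subtype.preconnectedSpace hU
  obtain ⟨σ, hσ⟩ := exists_perm_eq_of_preconnected (a := fun i => (r i).1)
    (b := fun i x => r' i (T.K₀ x)) (fun i => (r i).continuous)
    (fun i => (r' i).continuous.comp T.continuous_K₀) hr.distinct
    (fun x => hr'.distinct (T.K₀ x)) (h.exists_canonical_eq hr hr')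
  exact ⟨σ, fun i => Smooth.ext (hσ i)⟩

/-- After relabelling by `σ`, the coordinates `r'` pull back to `r`, so the diagonal entries of the
two metrics can be compared. -/
theorem MapsPencil.pullHom_diagonal {P : Pencil U} {P' : Pencil W} (h : T.MapsPencil P P')
    {r f : Fin N → Smooth U} (hr : P.IsCanonical r f) {r' f' : Fin N → Smooth W}
    (hr' : P'.IsCanonical r' f') {σ : Equiv.Perm (Fin N)}
    (hσ : ∀ i, T.pullHom (r' (σ i)) = r i) (i : Fin N) :
    T.pullHom (f' (σ i)) = T.H₀ ^ 2 * f i := by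
  have h1 := h.1.metric_congruence_map fun i => r' (σ i)
  rw [(Pencil.sum_pd_mul_pd_eq_iff (g := P'.fst.metric) (f := fun i => f' (σ i))).1 fun i j => by
      simpa using hr'.fst_metric (σ i) (σ j), show (fun i => T.pullHom (r' (σ i))) = r from
      funext hσ, (Pencil.sum_pd_mul_pd_eq_iff (g := P.fst.metric)).1 hr.fst_metric] at h1
  simpa using congrFun (congrFun h1 i) i

theorem MapsPencil.invariant_eq {P : Pencil U} {P' : Pencil W} (h : T.MapsPencil P P')
    {r f : Fin N → Smooth U} (hr : P.IsCanonical r f) {r' f' : Fin N → Smooth W}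
    (hr' : P'.IsCanonical r' f') {σ : Equiv.Perm (Fin N)}
    (hσ : ∀ i, T.pullHom (r' (σ i)) = r i) {lam : Fin N → PowerSeries (Smooth U)}
    {lam' : Fin N → PowerSeries (Smooth W)} (hlam : P.IsRootSystem r lam)
    (hlam' : P'.IsRootSystem r' lam') (i : Fin N) (k : ℕ) (x : U) :
    invariant (lam' (σ i)) (f' (σ i)) k (T.K₀ x) = invariant (lam i) (f i) k x := by
  -- Both are roots over `r i`, so they coincide.
  have hroot : T.symbolHom (lam' (σ i)) = lam i :=
    (hr.existsUnique_root i).unique ⟨h.symbolHom_isRoot (hlam' (σ i)).1, by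
      rw [T.constantCoeff_symbolHom, (hlam' (σ i)).2, hσ]⟩ (hlam i)
  have h1 : Smooth.ev x (PowerSeries.coeff (2 * k) (lam i)) =
      Smooth.ev x T.H₀inv ^ (2 * k) *
        Smooth.ev (T.K₀ x) (PowerSeries.coeff (2 * k) (lam' (σ i))) := by
    rw [← hroot, T.coeff_symbolHom, map_mul, map_pow]
    rfl
  have h2 : Smooth.ev (T.K₀ x) (f' (σ i)) = Smooth.ev x T.H₀ ^ 2 * Smooth.ev x (f i) := by
    rw [← map_pow, ← map_mul, ← h.pullHom_diagonal hr hr' hσ i]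
    rfl
  have h3 : Smooth.ev x T.H₀ * Smooth.ev x T.H₀inv = 1 := by
    rw [← map_mul, T.H₀_mul_H₀inv, map_one]
  have h4 : Smooth.ev x T.H₀ ≠ 0 := left_ne_zero_of_mul_eq_one h3
  have h5 : Smooth.ev x (f i) ≠ 0 := hr.nondegenerate x i
  change Smooth.ev (T.K₀ x) _ / Smooth.ev (T.K₀ x) (f' (σ i)) ^ k =
    Smooth.ev x _ / Smooth.ev x (f i) ^ k
  rw [h1, h2, eq_inv_of_mul_eq_one_right h3, mul_pow, ← pow_mul, inv_pow]
  field_simp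

end Transformation

end MiuraReciprocal

end

open MiuraReciprocal in
theorem mainTheorem4 (N : ℕ) (U W : TopologicalSpace.Opens (Fin N → ℝ))
    (hU : IsPreconnected (U : Set (Fin N → ℝ)))
    (P : Pencil U) (P' : Pencil W) (T : Transformation U W) (hT : T.MapsPencil P P')
    (r f : Fin N → Smooth U) (hr : P.IsCanonical r f) :
    (∃ lam, P.IsRootSystem r lam ∧ (∀ lam₁, P.IsRootSystem r lam₁ → lam₁ = lam) ∧
      ∀ i k, PowerSeries.coeff (2 * k + 1) (lam i) = 0) ∧
    (∃ r' f', P'.IsCanonical r' f') ∧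
    ∀ r' f', P'.IsCanonical r' f' →
      (∃ lam', P'.IsRootSystem r' lam' ∧ (∀ lam₁, P'.IsRootSystem r' lam₁ → lam₁ = lam') ∧
        ∀ i k, PowerSeries.coeff (2 * k + 1) (lam' i) = 0) ∧
      ∀ lam lam', P.IsRootSystem r lam → P'.IsRootSystem r' lam' →
        ∃ σ : Equiv.Perm (Fin N), ∀ i k x,
          invariant (lam' (σ i)) (f' (σ i)) k (T.K₀ x) = invariant (lam i) (f i) k x := by
  refine ⟨hr.roots, hT.exists_isCanonical hr,
    fun r' f' hr' => ⟨hr'.roots, fun lam lam' hl hl' => ?_⟩⟩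
  -- The permutation comes from the canonical coordinates alone, hence depends neither on `k` nor on
  -- the point.
  obtain ⟨σ, hσ⟩ := hT.exists_perm hU hr hr'
  exact ⟨σ, fun i k x => hT.invariant_eq hr hr' hσ hl hl' i k x⟩
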